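/- Let $R$ be a finite (not necessarily commutative) chain ring of length $2$, i.e. a finite ring whose left ideals form a chain and whose radical $\mathrm{rad}(R)$ is generated by an element of nilpotency index $2$; let $R/\mathrm{rad}(R)\cong\mathbb{F}_q$ be its residue field. A point of $\mathrm{Barb}(R^3_R)$ is a submodule $xR\le R^3_R$ such that $\varphi(x)=1$ for some $\varphi\in (R^3)^*=\mathrm{Hom}(R^3_R,R_R)$, and a hyperplane is a submodule $R\varphi\le (R^3)^*$ such that $\varphi(x)=1$ for some $x\in R^3$; a point $p$ and a hyperplane $h$ are incident if $p=xR$ and $h=R\varphi$ for some $x,\varphi$ with $\varphi(x)=0$. Let $\nu$ denote reduction modulo $\mathrm{rad}(R)$. Two points $p,p'$ are neighbours if $\nu(p)=\nu(p')$, and $[p]$ is the neighbour class of $p$. A line segment is a non-empty set $[p]_h$ consisting of all neighbours of a point $p$ that are incident with a hyperplane $h$; its direction is $\nu(h)$. Let $K$ be a set of points of $\mathrm{Barb}(R^3_R)$ that meets every neighbour class in a line segment, the directions of the segments in distinct classes being pairwise distinct. Let $Y$ be a $3\times n$ matrix over $R$ whose columns generate the points of $K$, each point exactly once, and let $C\le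 {}_RR^n$ be the left linear code generated by the rows of $Y$. Let $w$ be the normalized homogeneous weight on $R$, i.e. the unique map $w:R\to\mathbb{R}_{\ge 0}$ with $w(0)=0$, $w(x)=w(y)$ whenever $Rx=Ry$, and $\sum_{y\in Rx}w(y)=|Rx|$ for all $x\ne 0$, extended to $R^n$ by $w(c)=\sum_i w(c_i)$. Then $n=q(q^2+q+1)$, the code $C$ is free of rank $k=3$, and $C$ is a two-weight code: every nonzero word has positive weight, and $w$ takes on $C$ exactly the two distinct nonzero values $$w_1=\frac{q^4-q^2}{q-1},\qquad w_2=\frac{q^4}{q-1}.$$ Moreover, the graph with vertex set $C$ in which two words $x,y$ are adjacent if and only if $w(x-y)=w_1$ is strongly regular (neither empty nor complete) with parameters $$N=q^6,\quad K=q^5-q^2,\quad \lambda=q^4+q^3-3q^2,\quad \mu=q^2(q^2-1).$$ -/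

import Mathlib

section Weights

variable {R : Type*} [Ring R]

/-- A homogeneous weight of average value `γ` on a (finite) ring `R`. Here `Ideal R` is the type of
left ideals, so `Ideal.span {x}` is the principal left ideal `Rx`. -/
structure IsHomogeneousWeight (w : R → ℝ) (γ : ℝ) : Prop where
  nonneg : ∀ x, 0 ≤ w x
  map_zero : w 0 = 0
  eq_of_span_eq : ∀ x y : R, Ideal.span {x} = Ideal.span {y} → w x = w y
  sum_eq : ∀ x : R, x ≠ 0 →
    ∑ᶠ y ∈ (Ideal.span {x} : Set R), w y = γ * Nat.card (Ideal.span {x} : Ideal R)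

/-- On a finite ring, there is at most one homogeneous weight of average value `1`. -/
theorem IsHomogeneousWeight.unique [Finite R] {w v : R → ℝ}
    (hw : IsHomogeneousWeight w 1) (hv : IsHomogeneousWeight v 1) : w = v := by
  classical
  have key : ∀ n : ℕ, ∀ x : R, Nat.card (Ideal.span {x} : Ideal R) = n → w x = v x := by
    intro n
    induction n using Nat.strong_induction_on with
    | _ n ih =>
      intro x hx
      by_cases h0 : x = 0
      · rw [h0, hw.map_zero, hv.map_zero]
      have hs := (hw.sum_eq x h0).trans (hv.sum_eq x h0).symm
      have hfin : (Ideal.span {x} : Set R).Finite := Set.toFinite _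
      rw [finsum_mem_eq_finite_toFinset_sum _ hfin, finsum_mem_eq_finite_toFinset_sum _ hfin,
        ← sub_eq_zero, ← Finset.sum_sub_distrib] at hs
      have hterm : ∀ y ∈ hfin.toFinset,
          w y - v y = if Ideal.span {y} = Ideal.span {x} then w x - v x else 0 := by
        intro y hy
        have hy' : y ∈ Ideal.span {x} := by simpa using hy
        have hle : Ideal.span {y} ≤ Ideal.span {x} := by
          rw [Ideal.span_le]; simpa using hy'
        split_ifs with h
        · rw [hw.eq_of_span_eq y x h, hv.eq_of_span_eq y x h]
        · have hlt : Nat.card (Ideal.span {y} : Ideal R) < n := by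
            rw [← hx]
            have : ((Ideal.span {y} : Ideal R) : Set R) ⊂ (Ideal.span {x} : Ideal R) :=
              SetLike.coe_ssubset_coe.2 (lt_of_le_of_ne hle h)
            exact Set.ncard_lt_ncard this
          rw [ih _ hlt y rfl, sub_self]
      rw [Finset.sum_congr rfl hterm, ← Finset.sum_filter, Finset.sum_const, nsmul_eq_mul] at hs
      have hne : ((hfin.toFinset.filter
          (fun y => Ideal.span {y} = Ideal.span {x})).card : ℝ) ≠ 0 := by
        have : x ∈ hfin.toFinset.filter (fun y => Ideal.span {y} = Ideal.span {x}) := by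
          simp
        exact_mod_cast (Finset.card_pos.2 ⟨x, this⟩).ne'
      exact sub_eq_zero.1 ((mul_eq_zero.1 hs).resolve_left hne)
  funext x
  exact key _ x rfl

open Classical in
/-- The normalized homogeneous weight of a finite ring: the unique homogeneous weight of
average value `1` (with value `0` if there were none). -/
noncomputable def homWeight (R : Type*) [Ring R] : R → ℝ :=
  if h : ∃ w : R → ℝ, IsHomogeneousWeight w 1 then h.choose else 0

/-- The extension of the normalized homogeneous weight to `Rⁿ`. -/
noncomputable def codeWeight {n : ℕ} (c : Fin n → R) : ℝ := ∑ i, homWeight R (c i)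

end Weights

section ChainRings

/-- A left chain ring: the left ideals form a chain. -/
def IsChainRing (R : Type*) [Ring R] : Prop := ∀ I J : Ideal R, I ≤ J ∨ J ≤ I

/-- The length of a finite chain ring: the nilpotency index of a generator of its radical. -/
def HasChainLength (R : Type*) [Ring R] (m : ℕ) : Prop :=
  ∃ θ : R, Ring.jacobson R = Ideal.span {θ} ∧ nilpotencyClass θ = m

/-- The residue ring `R / rad R`; it is a finite field when `R` is a finite chain ring. -/
abbrev ResidueRing (R : Type*) [Ring R] : Type _ := R ⧸ Ring.jacobson R

/-- A finite chain ring of length two has a normalized homogeneous weight. -/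
theorem exists_homogeneousWeight {R : Type*} [Ring R] [Finite R] (hchain : IsChainRing R)
    (hlen : HasChainLength R 2) : ∃ w : R → ℝ, IsHomogeneousWeight w 1 := by
  classical
  obtain ⟨θ, hθ, hθ2⟩ := hlen
  have hsq : θ * θ = 0 := by
    have hne : {k : ℕ | θ ^ k = 0}.Nonempty := by
      by_contra h
      rw [Set.not_nonempty_iff_eq_empty] at h
      simp [nilpotencyClass, h] at hθ2
    have := Nat.sInf_mem hne
    rw [show sInf {k : ℕ | θ ^ k = 0} = 2 from hθ2] at this
    simpa [pow_two] using this
  have hθ0 : θ ≠ 0 := by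
    intro h
    have h1 : sInf {k : ℕ | θ ^ k = 0} ≤ 1 := Nat.sInf_le (by simp [h])
    rw [show sInf {k : ℕ | θ ^ k = 0} = 2 from hθ2] at h1
    omega
  have hnt : Nontrivial R := ⟨θ, 0, hθ0⟩
  have hunit : ∀ x : R, x ∉ Ring.jacobson R → Ideal.span {x} = ⊤ := by
    intro x hx
    by_contra hne
    obtain ⟨m, hm, hxm⟩ := Ideal.exists_le_maximal _ hne
    apply hx
    have : ∀ I : Ideal R, IsCoatom I → x ∈ I := by
      intro I hI
      have hxm' : x ∈ m := hxm (Ideal.mem_span_singleton_self x)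
      rcases hchain I m with h | h
      · rcases eq_or_lt_of_le h with h | h
        · rwa [h]
        · exact absurd (hI.2 _ h) hm.ne_top
      · exact h hxm'
    rw [Ring.jacobson, Module.jacobson, Submodule.mem_sInf]
    exact this
  have hann : ∀ a : R, a * θ = 0 ↔ a ∈ Ring.jacobson R := by
    intro a
    constructor
    · intro h
      by_contra ha
      have h1 : (1 : R) ∈ Ideal.span {a} := by rw [hunit a ha]; trivial
      obtain ⟨c, hc⟩ := Ideal.mem_span_singleton'.1 h1
      apply hθ0
      rw [← one_mul θ, ← hc, mul_assoc, h, mul_zero]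
    · intro h
      rw [hθ] at h
      obtain ⟨c, rfl⟩ := Ideal.mem_span_singleton'.1 h
      rw [mul_assoc, hsq, mul_zero]
  have hmin : ∀ x ∈ Ring.jacobson R, x ≠ 0 → Ideal.span {x} = Ring.jacobson R := by
    intro x hx hx0
    apply le_antisymm
    · rwa [Ideal.span_le, Set.singleton_subset_iff]
    · rw [hθ] at hx ⊢
      obtain ⟨a, rfl⟩ := Ideal.mem_span_singleton'.1 hx
      have ha : a ∉ Ring.jacobson R := fun h => hx0 ((hann a).2 h)
      have h1 : (1 : R) ∈ Ideal.span {a} := by rw [hunit a ha]; trivial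
      obtain ⟨c, hc⟩ := Ideal.mem_span_singleton'.1 h1
      rw [Ideal.span_le, Set.singleton_subset_iff]
      exact Ideal.mem_span_singleton'.2 ⟨c, by rw [← mul_assoc, hc, one_mul]⟩
  have hcard : Nat.card (ResidueRing R) = Nat.card (Ring.jacobson R) := by
    let f : R →ₗ[R] R := LinearMap.toSpanSingleton R R θ
    have hker : LinearMap.ker f = Ring.jacobson R := by
      ext a; simp [f, LinearMap.toSpanSingleton_apply, hann]
    have hrange : LinearMap.range f = Ring.jacobson R := by
      rw [hθ]; exact LinearMap.range_toSpanSingleton θ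
    have e := f.quotKerEquivRange
    rw [hker, hrange] at e
    exact Nat.card_congr e.toEquiv
  set q := Nat.card (Ring.jacobson R) with hqdef
  have hq2 : Nat.card R = q * q := by
    have h := Submodule.card_eq_card_quotient_mul_card (Ring.jacobson R)
    rw [h, show Nat.card (R ⧸ Ring.jacobson R) = q from hcard]
  have hθmem : θ ∈ Ring.jacobson R := by rw [hθ]; exact Ideal.mem_span_singleton_self θ
  have hq1 : 1 < q := by
    have : Nontrivial (Ring.jacobson R) :=
      ⟨⟨θ, hθmem⟩, 0, fun h => hθ0 (congrArg Subtype.val h)⟩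
    exact Finite.one_lt_card
  have hq1' : (q : ℝ) - 1 ≠ 0 := by
    have : (1 : ℝ) < q := by exact_mod_cast hq1
    linarith
  have hqpos : (0 : ℝ) < (q : ℝ) - 1 := by
    have : (1 : ℝ) < q := by exact_mod_cast hq1
    linarith
  let w : R → ℝ := fun x => if x = 0 then 0 else
    if x ∈ Ring.jacobson R then (q : ℝ) / ((q : ℝ) - 1) else 1
  have hsum : ∑ᶠ y ∈ (Ring.jacobson R : Set R), w y = q := by
    have hfin : (Ring.jacobson R : Set R).Finite := Set.toFinite _
    rw [finsum_mem_eq_finite_toFinset_sum _ hfin]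
    have h0 : (0 : R) ∈ hfin.toFinset := by simp
    rw [← Finset.add_sum_erase _ _ h0]
    have hc : ((hfin.toFinset.erase 0).card : ℝ) = q - 1 := by
      rw [Finset.card_erase_of_mem h0, ← Set.ncard_eq_toFinset_card _ hfin,
        Nat.cast_sub (by change 1 ≤ q; omega)]
      rw [show (Ring.jacobson R : Set R).ncard = q from rfl]
      simp
    rw [Finset.sum_congr rfl (g := fun _ => (q : ℝ) / ((q : ℝ) - 1)), Finset.sum_const,
      nsmul_eq_mul, hc]
    · simp only [w, if_true, zero_add]
      field_simp
    · intro y hy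
      simp only [Finset.mem_erase, Set.Finite.mem_toFinset, SetLike.mem_coe] at hy
      simp [w, hy.1, hy.2]
  refine ⟨w, ?_, ?_, ?_, ?_⟩
  · intro x
    simp only [w]
    split_ifs
    · exact le_rfl
    · positivity
    · exact zero_le_one
  · simp [w]
  · intro x y h
    have h0 : x = 0 ↔ y = 0 := by
      rw [← Ideal.span_singleton_eq_bot (α := R), h, Ideal.span_singleton_eq_bot]
    have h1 : x ∈ Ring.jacobson R ↔ y ∈ Ring.jacobson R := by
      rw [← Ideal.span_singleton_le_iff_mem, h, Ideal.span_singleton_le_iff_mem]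
    simp only [w, h0, h1]
  · intro x hx0
    rw [one_mul]
    by_cases hx : x ∈ Ring.jacobson R
    · rw [hmin x hx hx0, hsum]
    · rw [hunit x hx]
      have hfin : (Set.univ : Set R).Finite := Set.toFinite _
      have hdisj : Disjoint (Ring.jacobson R : Set R) (Ring.jacobson R : Set R)ᶜ :=
        disjoint_compl_right
      rw [Submodule.top_coe, ← Set.union_compl_self (Ring.jacobson R : Set R),
        finsum_mem_union hdisj (Set.toFinite _) (Set.toFinite _), hsum]
      have hout : ∑ᶠ y ∈ (Ring.jacobson R : Set R)ᶜ, w y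
          = ((Ring.jacobson R : Set R)ᶜ.ncard : ℝ) := by
        have hf : ((Ring.jacobson R : Set R)ᶜ).Finite := Set.toFinite _
        rw [finsum_mem_eq_finite_toFinset_sum _ hf, Set.ncard_eq_toFinset_card _ hf,
          Finset.sum_congr rfl (g := fun _ => (1 : ℝ))]
        · simp
        · intro y hy
          have hy' : y ∉ Ring.jacobson R := by simpa using hy
          have hy0 : y ≠ 0 := fun h => hy' (h ▸ zero_mem _)
          simp [w, hy', hy0]
      rw [hout, ← Nat.cast_add, show q = (Ring.jacobson R : Set R).ncard from rfl,
        Set.ncard_add_ncard_compl]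
      exact_mod_cast (Nat.card_congr (Submodule.topEquiv (R := R) (M := R)).toEquiv).symm

/-- On a finite chain ring of length two, `homWeight` is a homogeneous weight of average value
`1`, hence the only one. -/
theorem isHomogeneousWeight_homWeight {R : Type*} [Ring R] [Finite R] (hchain : IsChainRing R)
    (hlen : HasChainLength R 2) : IsHomogeneousWeight (homWeight R) 1 := by
  have h := exists_homogeneousWeight hchain hlen
  rw [homWeight, dif_pos h]
  exact h.choose_spec

end ChainRings

section Barbilian

open MulOpposite

variable (R : Type*) [Ring R] (M : Type*) [AddCommGroup M] [Module Rᵐᵒᵖ M]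

/-- The points `xR` of the Barbilian space of the right module `M_R`. Right `R`-modules are
`Rᵐᵒᵖ`-modules, and `M →ₗ[Rᵐᵒᵖ] R` is the dual `M* = Hom(M_R, R_R)`. -/
def barbPoints : Set (Submodule Rᵐᵒᵖ M) :=
  {P | ∃ x : M, (∃ φ : M →ₗ[Rᵐᵒᵖ] R, φ x = 1) ∧ P = Submodule.span Rᵐᵒᵖ {x}}

/-- The hyperplanes `Rφ` of the Barbilian space of `M_R`. -/
def barbHyperplanes : Set (Submodule R (M →ₗ[Rᵐᵒᵖ] R)) :=
  {H | ∃ φ : M →ₗ[Rᵐᵒᵖ] R, (∃ x : M, φ x = 1) ∧ H = Submodule.span R {φ}}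

variable {R M}

/-- Incidence of a point and a hyperplane in the Barbilian space of `M_R`. -/
def BarbIncident (P : Submodule Rᵐᵒᵖ M) (H : Submodule R (M →ₗ[Rᵐᵒᵖ] R)) : Prop :=
  P ∈ barbPoints R M ∧ H ∈ barbHyperplanes R M ∧
    ∃ (φ : M →ₗ[Rᵐᵒᵖ] R) (x : M),
      H = Submodule.span R {φ} ∧ P = Submodule.span Rᵐᵒᵖ {x} ∧ φ x = 0

end Barbilian

section Segments

variable {R : Type*} [Ring R] {k : ℕ}

/-- The natural epimorphism `ν : Rᵏ → (R / rad R)ᵏ`. -/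
def nuVec (x : Fin k → R) : Fin k → ResidueRing R := fun i => Submodule.Quotient.mk (x i)

/-- The image `ν(P)` of a submodule `P` of the right module `Rᵏ`. -/
def nuPoint (P : Submodule Rᵐᵒᵖ (Fin k → R)) : Set (Fin k → ResidueRing R) :=
  nuVec '' (P : Set (Fin k → R))

/-- The image `ν(H)` of a hyperplane `H = Rφ`, where a functional `ψ` on `Rᵏ` is written as the
row `(ψ e₁, …, ψ e_k)` of its coordinates: the set of all coordinate rows over `R / rad R` of the
image hyperplane. -/
def nuHyperplane (H : Submodule R ((Fin k → R) →ₗ[Rᵐᵒᵖ] R)) : Set (Fin k → ResidueRing R) :=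
  (fun ψ : (Fin k → R) →ₗ[Rᵐᵒᵖ] R => nuVec (fun i => ψ (Pi.single i 1))) ''
    (H : Set ((Fin k → R) →ₗ[Rᵐᵒᵖ] R))

/-- The neighbour relation. -/
def Neighbour (P Q : Submodule Rᵐᵒᵖ (Fin k → R)) : Prop := nuPoint P = nuPoint Q

/-- The set `[p]_h` of the points that are neighbours of `p` and incident with `h`; it is a line
segment when it is non-empty, and `nuHyperplane h` is then its direction. -/
def segment_of (p : Submodule Rᵐᵒᵖ (Fin k → R)) (h : Submodule R ((Fin k → R) →ₗ[Rᵐᵒᵖ] R)) :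
    Set (Submodule Rᵐᵒᵖ (Fin k → R)) :=
  {g | g ∈ barbPoints R (Fin k → R) ∧ Neighbour g p ∧ BarbIncident g h}

/-- `K` is a set of points that meets every neighbour class `[p]` in a line segment `[p]_{η p}`,
and the directions of the segments in different neighbour classes are different. -/
def MeetsClassesInSegments (K : Set (Submodule Rᵐᵒᵖ (Fin k → R))) : Prop :=
  K ⊆ barbPoints R (Fin k → R) ∧
  ∃ η : Submodule Rᵐᵒᵖ (Fin k → R) → Submodule R ((Fin k → R) →ₗ[Rᵐᵒᵖ] R),
    (∀ p ∈ barbPoints R (Fin k → R), η p ∈ barbHyperplanes R (Fin k → R) ∧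
      (segment_of p (η p)).Nonempty ∧ {g ∈ K | Neighbour g p} = segment_of p (η p)) ∧
    ∀ p ∈ barbPoints R (Fin k → R), ∀ p' ∈ barbPoints R (Fin k → R),
      ¬ Neighbour p p' → nuHyperplane (η p) ≠ nuHyperplane (η p')

end Segments

section Codes

variable {R : Type*} [Ring R] {n : ℕ}

/-- The left linear code generated by a matrix: its row space in the left module `Rⁿ`. -/
def codeOf {k : ℕ} (Y : Matrix (Fin k) (Fin n) R) : Submodule R (Fin n → R) :=
  Submodule.span R (Set.range fun i => Y i)

/-- The right submodule `y_j R` of `Rᵏ` generated by the `j`-th column of a matrix. -/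
def columnSpan {k : ℕ} (Y : Matrix (Fin k) (Fin n) R) (j : Fin n) :
    Submodule Rᵐᵒᵖ (Fin k → R) :=
  Submodule.span Rᵐᵒᵖ {fun i => Y i j}

/-- A code is proper if all its nonzero words have positive normalized homogeneous weight. -/
def IsProperCode (C : Submodule R (Fin n → R)) : Prop :=
  ∀ c ∈ C, c ≠ 0 → 0 < codeWeight c

/-- A two-weight code: a proper code on which the normalized homogeneous weight takes exactly the
two nonzero values `w₁` and `w₂`. -/
def IsTwoWeightCode (C : Submodule R (Fin n → R)) (w₁ w₂ : ℝ) : Prop :=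
  IsProperCode C ∧ w₁ ≠ w₂ ∧ (codeWeight '' (C : Set (Fin n → R))) \ {0} = {w₁, w₂}

/-- The graph on the words of `C` in which distinct words `x, y` are adjacent if `x - y` has weight
`w₁` (a symmetric relation, as `x - y` and `y - x` have the same weight). -/
def codeGraph (C : Submodule R (Fin n → R)) (w₁ : ℝ) : SimpleGraph C :=
  SimpleGraph.fromRel fun x y => codeWeight ((x : Fin n → R) - (y : Fin n → R)) = w₁

open Classical in
/-- A strongly regular graph with parameters `(N, K, l, m)`, neither empty nor complete. -/
def IsStronglyRegular {V : Type*} [Finite V] (G : SimpleGraph V) (N K l m : ℕ) : Prop :=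
  letI := Fintype.ofFinite V
  G ≠ ⊥ ∧ G ≠ ⊤ ∧ G.IsSRGWith N K l m

end Codes

/-! Let `π` be reduction modulo the radical. The radical has square zero and order q, so a product
with a radical factor sees the other factor only modulo the radical. In effect the radical is a
one-dimensional space over the residue field `F` on either side.

A point has q² - q generators, which differ by right units. So (q² - q) times the weight of the word
`uY` is the sum of w(u·z) over the cone of all generators z of points of `K`. Above a nonzero ξ in
F³ the cone consists of the q² lifts z of ξ with φ(ξ)·z = 0, where φ(ξ) is a row defining the
segment. The rows can be normalized so that ξ ↦ π(φ(ξ)) commutes with scalars. Distinct directions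
make this map injective, hence a permutation of the nonzero vectors.

If u ≠ 0 is radical, u·z depends linearly on ξ alone and the sum is q⁵. If π(u) ≠ 0, exactly one
line of vectors ξ has π(φ(ξ)) proportional to π(u). Off that line u and φ(ξ) are independent modulo
the radical, so u·z is equidistributed over a residue class, on which w has average 1
(`exists_polarSystem`). On the line u·z is one fixed radical element up to right units
(`dotProduct_eq_mul`), of weight 0 or q/(q-1). The sum is therefore q²(q³ - q) or again q⁵, which
gives the two weights.

The rows of weight w₁ form `polarSet`: those u with π(u) ≠ 0 that vanish at the point b(π(u)) of the
segment with direction π(u). This set has the same shape as the cone, with rows and columns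
exchanged, and it is a partial difference set in R³. To count the s for which s and s - d both lie
in it, fix σ = π(s). Off the line of π(d) there are two independent conditions and q solutions. On
that line both conditions concern the same point, so they are compatible exactly when d lies in the
set. A radical d requires a separate count (`card_sub_mem_of_map_eq_zero`), which yields the same μ.
-/

section FibreSums

/-! ### Averaging over fibres and cosets of finite groups -/

variable {A B M : Type*} [AddCommGroup A] [AddCommGroup B] [Fintype A] [Fintype B]
  [AddCommMonoid M]

/-- Summing over the source of a surjective homomorphism of finite groups amounts to summing over
the target, up to the order of the kernel. -/
theorem AddMonoidHom.card_nsmul_sum_comp (f : A →+ B) (hf : Function.Surjective f) (g : B → M) :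
    Fintype.card B • ∑ a, g (f a) = Fintype.card A • ∑ b, g b := by
  classical
  have hfib : ∀ b, ({a | f a = b} : Finset A).card = ({a | f a = 0} : Finset A).card := fun b =>
    AddMonoidHom.card_fiber_eq_of_mem_range f (hf b) (hf 0)
  have hcard : Fintype.card A = Fintype.card B * ({a | f a = 0} : Finset A).card := by
    rw [← Finset.card_univ, Finset.card_eq_sum_card_fiberwise (f := f) (t := Finset.univ)
      (by simp), Finset.sum_congr rfl fun b _ => hfib b]
    simp
  have hsum : ∑ a, g (f a) = ({a | f a = 0} : Finset A).card • ∑ b, g b := by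
    rw [← Finset.sum_fiberwise (s := Finset.univ) (g := f), Finset.smul_sum]
    refine Finset.sum_congr rfl fun b _ => ?_
    rw [← hfib b, ← Finset.sum_const]
    refine Finset.sum_congr rfl fun a ha => ?_
    rw [(Finset.mem_filter.1 ha).2]
  rw [hsum, hcard, mul_smul]

-- Translating by `s` turns the coset sum into a sum over the subgroup, where all fibres have the
-- same size. Every equidistribution statement below is an instance; the two orders stay on opposite
-- sides so that the values may lie in any commutative monoid.
open Classical in
theorem AddMonoidHom.card_nsmul_sum_coset (f : A →+ B) {A₀ : AddSubgroup A} {B₀ : AddSubgroup B}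
    (hmem : ∀ a ∈ A₀, f a ∈ B₀) (hsurj : ∀ b ∈ B₀, ∃ a ∈ A₀, f a = b) (s : A) (g : B → M) :
    Nat.card B₀ • ∑ a with a - s ∈ A₀, g (f a) = Nat.card A₀ • ∑ b with b - f s ∈ B₀, g b := by
  let f₀ : A₀ →+ B₀ := (f.comp A₀.subtype).codRestrict B₀ fun a => hmem a a.2
  have hf₀ : Function.Surjective f₀ := by
    rintro ⟨b, hb⟩
    obtain ⟨a, ha, rfl⟩ := hsurj b hb
    exact ⟨⟨a, ha⟩, rfl⟩
  have key := f₀.card_nsmul_sum_comp hf₀ fun b => g (f s + b)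
  rw [Nat.card_eq_fintype_card, Nat.card_eq_fintype_card]
  convert key using 2
  · refine Finset.sum_bij' (fun a ha => ⟨a - s, (Finset.mem_filter.1 ha).2⟩)
      (fun m _ => s + m) (by simp) (by simp) (by simp) (by simp) fun a _ => ?_
    change g (f a) = g (f s + f (a - s))
    rw [map_sub, add_sub_cancel]
  · refine Finset.sum_bij' (fun b hb => ⟨b - f s, (Finset.mem_filter.1 hb).2⟩)
      (fun m _ => f s + m) ?_ ?_ ?_ ?_ ?_ <;> simp

end FibreSums

/-! ### Separating vectors over the residue field -/

section FieldVectors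

variable {F : Type*} [Field F] {ι : Type*}

theorem exists_dotProduct_eq_one [Fintype ι] {x y : ι → F} (h : ∀ c : F, x ≠ c • y) :
    ∃ z : ι → F, x ⬝ᵥ z = 1 ∧ y ⬝ᵥ z = 0 := by
  classical
  have hx : x ∉ Submodule.span F {y} := by
    rw [Submodule.mem_span_singleton]
    rintro ⟨c, hc⟩
    exact h c hc.symm
  obtain ⟨f, hfx, hf⟩ := Submodule.exists_le_ker_of_notMem hx
  have hfy : f y = 0 := hf (Submodule.mem_span_singleton_self y)
  have hdot : ∀ v, v ⬝ᵥ (fun i => f fun j => if i = j then 1 else 0) = f v := fun v =>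
    (LinearMap.pi_apply_eq_sum_univ f v).symm
  refine ⟨(f x)⁻¹ • fun i => f fun j => if i = j then 1 else 0, ?_, ?_⟩
  · rw [dotProduct_smul, hdot, smul_eq_mul, inv_mul_cancel₀ hfx]
  · rw [dotProduct_smul, hdot, hfy, smul_zero]

theorem exists_dotProduct_eq_one_of_ne_zero [Fintype ι] {x : ι → F} (h : x ≠ 0) :
    ∃ z : ι → F, x ⬝ᵥ z = 1 := by
  obtain ⟨z, hz, -⟩ := exists_dotProduct_eq_one (x := x) (y := 0) (by simpa using h)
  exact ⟨z, hz⟩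

theorem ne_smul_symm {x y : ι → F} (hy : y ≠ 0) (h : ∀ c : F, x ≠ c • y) (c : F) :
    y ≠ c • x := by
  rintro hc
  have hc0 : c ≠ 0 := by rintro rfl; exact hy (by simpa using hc)
  exact h c⁻¹ (by rw [hc, smul_smul, inv_mul_cancel₀ hc0, one_smul])

end FieldVectors

/-! ### Arithmetic modulo a radical of square zero -/

/-- The reduction map of a finite chain ring of length at most two onto its residue field. -/
structure IsLengthTwoReduction {R F : Type*} [Ring R] [Field F] (π : R →+* F) : Prop where
  surjective : Function.Surjective π
  isUnit : ∀ x, π x ≠ 0 → IsUnit x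
  mul_eq_zero : ∀ x y, π x = 0 → π y = 0 → x * y = 0
  card_ker : Nat.card (RingHom.ker π) = Nat.card F

namespace IsLengthTwoReduction

variable {R F : Type*} [Ring R] [Field F] {π : R →+* F} (hπ : IsLengthTwoReduction π)

theorem exists_lift (hπ : IsLengthTwoReduction π) {ι : Type*} (ξ : ι → F) :
    ∃ x : ι → R, π ∘ x = ξ := by
  choose g hg using hπ.surjective
  exact ⟨g ∘ ξ, funext fun i => hg _⟩

/-- The difference `x - x'` is radical, and two radical elements multiply to zero. -/
theorem mul_congr_left (hπ : IsLengthTwoReduction π) {x x' y : R} (hx : π x = π x')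
    (hy : π y = 0) : x * y = x' * y := by
  have := hπ.mul_eq_zero (x - x') y (by rw [map_sub, hx, sub_self]) hy
  rwa [sub_mul, sub_eq_zero] at this

theorem mul_congr_right (hπ : IsLengthTwoReduction π) {x y y' : R} (hy : π y = π y')
    (hx : π x = 0) : x * y = x * y' := by
  have := hπ.mul_eq_zero x (y - y') hx (by rw [map_sub, hy, sub_self])
  rwa [mul_sub, sub_eq_zero] at this

theorem dotProduct_congr_left (hπ : IsLengthTwoReduction π) {ι : Type*} [Fintype ι]
    {u u' m : ι → R} (hu : π ∘ u = π ∘ u') (hm : π ∘ m = 0) : u ⬝ᵥ m = u' ⬝ᵥ m :=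
  Finset.sum_congr rfl fun i _ => hπ.mul_congr_left (congrFun hu i) (congrFun hm i)

theorem dotProduct_congr_right (hπ : IsLengthTwoReduction π) {ι : Type*} [Fintype ι]
    {x x' m : ι → R} (hx : π ∘ x = π ∘ x') (hm : π ∘ m = 0) : m ⬝ᵥ x = m ⬝ᵥ x' :=
  Finset.sum_congr rfl fun i _ => hπ.mul_congr_right (congrFun hx i) (congrFun hm i)

/-- The vectors that reduce to zero. -/
def kerVec (π : R →+* F) (ι : Type*) : AddSubgroup (ι → R) where
  carrier := {m | π ∘ m = 0}
  add_mem' {a b} ha hb := by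
    funext i
    have h1 := congrFun ha i
    have h2 := congrFun hb i
    simp_all
  zero_mem' := by funext i; simp
  neg_mem' {a} ha := by
    funext i
    have h1 := congrFun ha i
    simp_all

theorem mem_kerVec {ι : Type*} {m : ι → R} : m ∈ kerVec π ι ↔ π ∘ m = 0 := Iff.rfl

theorem sub_mem_kerVec {ι : Type*} {x y : ι → R} : x - y ∈ kerVec π ι ↔ π ∘ x = π ∘ y := by
  simp only [mem_kerVec, funext_iff, Function.comp_apply, Pi.sub_apply, map_sub, sub_eq_zero,
    Pi.zero_apply]

theorem card_kerVec (hπ : IsLengthTwoReduction π) [Finite R] {k : ℕ} :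
    Nat.card (kerVec π (Fin k)) = Nat.card F ^ k := by
  rw [← hπ.card_ker]
  have e : kerVec π (Fin k) ≃ (Fin k → RingHom.ker π) :=
    { toFun := fun m i => ⟨m.1 i, congrFun m.2 i⟩
      invFun := fun m => ⟨fun i => m i, funext fun i => (m i).2⟩
      left_inv := fun _ => rfl
      right_inv := fun _ => rfl }
  rw [Nat.card_congr e, Nat.card_fun]
  simp

/-- The linear form `m ↦ u ⬝ᵥ m` given by a row. -/
def rowHom {k : ℕ} (u : Fin k → R) : (Fin k → R) →+ R where
  toFun m := u ⬝ᵥ m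
  map_zero' := dotProduct_zero u
  map_add' := dotProduct_add u

/-- The linear form `m ↦ m ⬝ᵥ x` given by a column. -/
def colHom {k : ℕ} (x : Fin k → R) : (Fin k → R) →+ R where
  toFun m := m ⬝ᵥ x
  map_zero' := zero_dotProduct x
  map_add' m m' := add_dotProduct m m' x

theorem rowHom_apply {k : ℕ} (u m : Fin k → R) : rowHom u m = u ⬝ᵥ m := by rw [rowHom]; rfl

theorem colHom_apply {k : ℕ} (x m : Fin k → R) : colHom x m = m ⬝ᵥ x := by rw [colHom]; rfl

theorem map_dotProduct_eq_zero_left {k : ℕ} (u : Fin k → R) {m : Fin k → R} (hm : π ∘ m = 0) :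
    π (u ⬝ᵥ m) = 0 := by
  rw [RingHom.map_dotProduct, hm, dotProduct_zero]

theorem map_dotProduct_eq_zero_right {k : ℕ} (u : Fin k → R) {m : Fin k → R} (hm : π ∘ m = 0) :
    π (m ⬝ᵥ u) = 0 := by
  rw [RingHom.map_dotProduct, hm, zero_dotProduct]

theorem comp_mul_right_eq_zero {k : ℕ} (x : Fin k → R) {t : R} (ht : π t = 0) :
    π ∘ (fun i => x i * t) = 0 := by
  funext i; simp [ht]

theorem comp_mul_left_eq_zero {k : ℕ} (x : Fin k → R) {t : R} (ht : π t = 0) :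
    π ∘ (fun i => t * x i) = 0 := by
  funext i; simp [ht]

theorem dotProduct_mul_right {k : ℕ} (u x : Fin k → R) (t : R) :
    u ⬝ᵥ (fun i => x i * t) = (u ⬝ᵥ x) * t := by
  simp [dotProduct, Finset.sum_mul, mul_assoc]

theorem dotProduct_mul_left {k : ℕ} (u x : Fin k → R) (t : R) :
    (fun i => t * u i) ⬝ᵥ x = t * (u ⬝ᵥ x) := by
  simp [dotProduct, Finset.mul_sum, mul_assoc]

/-- Independence over `F` gives vectors α, β dual to the reductions of `u` and `v`; the solution is
`a * s + b * t` for lifts `a`, `b`. The lifts satisfy the duality relations only modulo the radical,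
which suffices because `s` and `t` are radical. -/
theorem exists_rows_eq (hπ : IsLengthTwoReduction π) {k : ℕ} {u v : Fin k → R}
    (hv : π ∘ v ≠ 0) (h : ∀ c : F, π ∘ u ≠ c • π ∘ v) {s t : R} (hs : π s = 0) (ht : π t = 0) :
    ∃ m, π ∘ m = 0 ∧ u ⬝ᵥ m = s ∧ v ⬝ᵥ m = t := by
  obtain ⟨α, h1, h2⟩ := exists_dotProduct_eq_one h
  obtain ⟨β, h3, h4⟩ := exists_dotProduct_eq_one (ne_smul_symm hv h)
  obtain ⟨a, rfl⟩ := hπ.exists_lift α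
  obtain ⟨b, rfl⟩ := hπ.exists_lift β
  rw [← RingHom.map_dotProduct] at h1 h2 h3 h4
  refine ⟨(fun i => a i * s) + fun i => b i * t,
    (kerVec π _).add_mem (comp_mul_right_eq_zero a hs) (comp_mul_right_eq_zero b ht), ?_, ?_⟩
  · rw [dotProduct_add, dotProduct_mul_right, dotProduct_mul_right,
      hπ.mul_congr_left (h1.trans π.map_one.symm) hs, hπ.mul_eq_zero _ _ h4 ht, one_mul, add_zero]
  · rw [dotProduct_add, dotProduct_mul_right, dotProduct_mul_right,
      hπ.mul_congr_left (h3.trans π.map_one.symm) ht, hπ.mul_eq_zero _ _ h2 hs, one_mul, zero_add]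

theorem exists_columns_eq (hπ : IsLengthTwoReduction π) {k : ℕ} {x y : Fin k → R}
    (hy : π ∘ y ≠ 0) (h : ∀ c : F, π ∘ x ≠ c • π ∘ y) {s t : R} (hs : π s = 0) (ht : π t = 0) :
    ∃ m, π ∘ m = 0 ∧ m ⬝ᵥ x = s ∧ m ⬝ᵥ y = t := by
  obtain ⟨α, h1, h2⟩ := exists_dotProduct_eq_one h
  obtain ⟨β, h3, h4⟩ := exists_dotProduct_eq_one (ne_smul_symm hy h)
  obtain ⟨a, rfl⟩ := hπ.exists_lift α
  obtain ⟨b, rfl⟩ := hπ.exists_lift β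
  rw [dotProduct_comm, ← RingHom.map_dotProduct] at h1 h2 h3 h4
  refine ⟨(fun i => s * a i) + fun i => t * b i,
    (kerVec π _).add_mem (comp_mul_left_eq_zero a hs) (comp_mul_left_eq_zero b ht), ?_, ?_⟩
  · rw [add_dotProduct, dotProduct_mul_left, dotProduct_mul_left,
      hπ.mul_congr_right (h1.trans π.map_one.symm) hs, hπ.mul_eq_zero _ _ ht h4, mul_one, add_zero]
  · rw [add_dotProduct, dotProduct_mul_left, dotProduct_mul_left,
      hπ.mul_congr_right (h3.trans π.map_one.symm) ht, hπ.mul_eq_zero _ _ hs h2, mul_one, zero_add]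

theorem exists_row_eq (hπ : IsLengthTwoReduction π) {k : ℕ} {u : Fin k → R}
    (hu : π ∘ u ≠ 0) {s : R} (hs : π s = 0) : ∃ m, π ∘ m = 0 ∧ u ⬝ᵥ m = s := by
  obtain ⟨α, h1⟩ := exists_dotProduct_eq_one_of_ne_zero hu
  obtain ⟨a, rfl⟩ := hπ.exists_lift α
  rw [← RingHom.map_dotProduct] at h1
  refine ⟨fun i => a i * s, comp_mul_right_eq_zero a hs, ?_⟩
  rw [dotProduct_mul_right, hπ.mul_congr_left (h1.trans π.map_one.symm) hs, one_mul]

theorem exists_column_eq (hπ : IsLengthTwoReduction π) {k : ℕ} {x : Fin k → R}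
    (hx : π ∘ x ≠ 0) {s : R} (hs : π s = 0) : ∃ m, π ∘ m = 0 ∧ m ⬝ᵥ x = s := by
  obtain ⟨α, h1⟩ := exists_dotProduct_eq_one_of_ne_zero hx
  obtain ⟨a, rfl⟩ := hπ.exists_lift α
  rw [dotProduct_comm, ← RingHom.map_dotProduct] at h1
  refine ⟨fun i => s * a i, comp_mul_left_eq_zero a hs, ?_⟩
  rw [dotProduct_mul_left, hπ.mul_congr_right (h1.trans π.map_one.symm) hs, mul_one]

/-! ### Equidistribution of linear forms on residue classes -/

variable [Fintype R] [Fintype F] [DecidableEq F]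

/-- A residue class is a coset of the q³ radical vectors, mapped onto a coset of the q radical
elements, so each value is taken q³ / q = q² times. -/
theorem sum_residue_class_one (hπ : IsLengthTwoReduction π) (f : (Fin 3 → R) →+ R)
    (hmem : ∀ m, π ∘ m = 0 → π (f m) = 0) (hsurj : ∀ t, π t = 0 → ∃ m, π ∘ m = 0 ∧ f m = t)
    (s : Fin 3 → R) (g : R → ℝ) :
    ∑ x with π ∘ x = π ∘ s, g (f x) =
      (Fintype.card F : ℝ) ^ 2 * ∑ t with π t = π (f s), g t := by
  have key := f.card_nsmul_sum_coset (A₀ := kerVec π (Fin 3)) (B₀ := π.toAddMonoidHom.ker)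
    (fun m hm => hmem m hm) (fun t ht => hsurj t ht) s g
  have hq : (Fintype.card F : ℝ) ≠ 0 := by exact_mod_cast Fintype.card_ne_zero
  have hk : Nat.card π.toAddMonoidHom.ker = Nat.card F := hπ.card_ker
  have hJ : ∀ t, t - f s ∈ π.toAddMonoidHom.ker ↔ π t = π (f s) := fun t => by
    rw [AddMonoidHom.mem_ker]; simp [sub_eq_zero]
  rw [hπ.card_kerVec, hk, nsmul_eq_mul, nsmul_eq_mul, Nat.card_eq_fintype_card] at key
  simp only [sub_mem_kerVec, hJ] at key
  refine mul_left_cancel₀ hq ?_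
  rw [← mul_assoc, ← pow_succ']
  push_cast at key
  convert key

/-- Two independent forms map the q³ radical vectors onto the q² pairs of radical elements, which
leaves the factor q. -/
theorem sum_residue_class_two (hπ : IsLengthTwoReduction π) (f f' : (Fin 3 → R) →+ R)
    (hmem : ∀ m, π ∘ m = 0 → π (f m) = 0 ∧ π (f' m) = 0)
    (hsurj : ∀ t t', π t = 0 → π t' = 0 → ∃ m, π ∘ m = 0 ∧ f m = t ∧ f' m = t')
    (s : Fin 3 → R) (g : R → R → ℝ) :
    ∑ x with π ∘ x = π ∘ s, g (f x) (f' x) =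
      (Fintype.card F : ℝ) * ∑ t with π t = π (f s), ∑ t' with π t' = π (f' s), g t t' := by
  classical
  have key := (f.prod f').card_nsmul_sum_coset (A₀ := kerVec π (Fin 3))
    (B₀ := π.toAddMonoidHom.ker.prod π.toAddMonoidHom.ker)
    (fun m hm => hmem m hm)
    (fun t ht => by
      obtain ⟨m, hm, h1, h2⟩ := hsurj t.1 t.2 ht.1 ht.2
      exact ⟨m, hm, Prod.ext h1 h2⟩) s (fun p => g p.1 p.2)
  have hq : (Fintype.card F : ℝ) ≠ 0 := by exact_mod_cast Fintype.card_ne_zero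
  have hk : Nat.card (π.toAddMonoidHom.ker.prod π.toAddMonoidHom.ker) = Nat.card F ^ 2 := by
    rw [Nat.card_congr (AddSubgroup.prodEquiv _ _).toEquiv, Nat.card_prod, sq]
    exact congrArg₂ _ hπ.card_ker hπ.card_ker
  have hJ : ∀ t : R × R, t - (f.prod f') s ∈ π.toAddMonoidHom.ker.prod π.toAddMonoidHom.ker ↔
      π t.1 = π (f s) ∧ π t.2 = π (f' s) := fun t => by
    simp [AddSubgroup.mem_prod, AddMonoidHom.mem_ker, sub_eq_zero]
  rw [hπ.card_kerVec, hk, nsmul_eq_mul, nsmul_eq_mul, Nat.card_eq_fintype_card] at key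
  simp only [sub_mem_kerVec, hJ] at key
  refine mul_left_cancel₀ (pow_ne_zero 2 hq) ?_
  rw [← mul_assoc, ← pow_succ, ← Finset.sum_product', ← Finset.filter_product,
    Finset.univ_product_univ]
  push_cast at key
  simp only [AddMonoidHom.prod_apply] at key
  convert key

/-- For a nonzero row `u` in the radical, `u ⬝ᵥ x` depends only on the reduction of `x`, and takes
every value in the radical equally often. -/
theorem sum_row_radical (hπ : IsLengthTwoReduction π) {u : Fin 3 → R} (hu : π ∘ u = 0)
    (hu0 : u ≠ 0) (l : (Fin 3 → F) → Fin 3 → R) (hl : ∀ ξ, π ∘ l ξ = ξ) (g : R → ℝ) :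
    ∑ ξ, g (u ⬝ᵥ l ξ) = (Fintype.card F : ℝ) ^ 2 * ∑ t with π t = 0, g t := by
  classical
  let f : (Fin 3 → F) →+ R := AddMonoidHom.mk' (fun ξ => u ⬝ᵥ l ξ) fun ξ η => by
    rw [← dotProduct_add]
    refine hπ.dotProduct_congr_right ?_ hu
    rw [hl]
    conv_lhs => rw [← hl ξ, ← hl η]
    funext i
    simp
  obtain ⟨i, hi⟩ : ∃ i, u i ≠ 0 := Function.ne_iff.1 hu0
  have hui : π (u i) = 0 := congrFun hu i
  choose a ha using hπ.surjective
  -- One nonzero coordinate already reaches the whole radical: `c ↦ u i * a c` is injective because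
  -- differences of lifts of distinct scalars are units, and the radical has exactly q elements.
  let e : F → RingHom.ker π := fun c => ⟨u i * a c, by rw [RingHom.mem_ker, map_mul, hui, zero_mul]⟩
  have he : Function.Injective e := fun c c' h => by
    by_contra hc
    have h1 : u i * (a c - a c') = 0 := by
      rw [mul_sub, sub_eq_zero]; exact congrArg Subtype.val h
    have h2 : IsUnit (a c - a c') := hπ.isUnit _ (by rwa [map_sub, ha, ha, sub_ne_zero])
    exact hi (h2.mul_left_eq_zero.1 h1)
  have he' : Function.Bijective e := (Fintype.bijective_iff_injective_and_card e).2
    ⟨he, by rw [← Nat.card_eq_fintype_card, ← Nat.card_eq_fintype_card, hπ.card_ker]⟩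
  have key := f.card_nsmul_sum_coset (A₀ := ⊤) (B₀ := π.toAddMonoidHom.ker)
    (fun ξ _ => map_dotProduct_eq_zero_right _ hu)
    (fun t ht => by
      obtain ⟨c, hc⟩ := he'.2 ⟨t, ht⟩
      refine ⟨Pi.single i c, trivial, ?_⟩
      have h1 : f (Pi.single i c) = u ⬝ᵥ Pi.single i (a c) := by
        refine hπ.dotProduct_congr_right ?_ hu
        rw [hl]
        funext j
        by_cases hj : j = i
        · subst hj; simp [ha]
        · simp [hj]
      rw [h1, dotProduct_single]
      exact congrArg Subtype.val hc) 0 g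
  have hq : (Fintype.card F : ℝ) ≠ 0 := by exact_mod_cast Fintype.card_ne_zero
  have hk : Nat.card π.toAddMonoidHom.ker = Nat.card F := hπ.card_ker
  have hJ : ∀ t, t ∈ π.toAddMonoidHom.ker ↔ π t = 0 := fun t => AddMonoidHom.mem_ker
  rw [hk, AddSubgroup.card_top, nsmul_eq_mul, nsmul_eq_mul, Nat.card_eq_fintype_card,
    Nat.card_eq_fintype_card, Fintype.card_fun, Fintype.card_fin] at key
  simp only [AddSubgroup.mem_top, Finset.filter_true, map_zero, sub_zero, hJ] at key
  refine mul_left_cancel₀ hq ?_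
  rw [← mul_assoc, ← pow_succ']
  push_cast at key
  exact key

variable [DecidableEq R]

/-- The condition `v ⬝ᵥ x = 0` is one value of the second of two independent forms; the first
remains equidistributed on its residue class. -/
theorem sum_rows (hπ : IsLengthTwoReduction π) {u v : Fin 3 → R} (hv : π ∘ v ≠ 0)
    (h : ∀ c : F, π ∘ u ≠ c • π ∘ v) {ξ : Fin 3 → F} (hvξ : π ∘ v ⬝ᵥ ξ = 0) (g : R → ℝ) :
    ∑ x with π ∘ x = ξ ∧ v ⬝ᵥ x = 0, g (u ⬝ᵥ x) =
      Fintype.card F * ∑ t with π t = π ∘ u ⬝ᵥ ξ, g t := by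
  obtain ⟨s, rfl⟩ := hπ.exists_lift ξ
  have key := hπ.sum_residue_class_two (rowHom u) (rowHom v)
    (fun m hm => ⟨map_dotProduct_eq_zero_left _ hm, map_dotProduct_eq_zero_left _ hm⟩)
    (fun t t' ht ht' => hπ.exists_rows_eq hv h ht ht') s (fun t t' => if t' = 0 then g t else 0)
  simp only [rowHom_apply, RingHom.map_dotProduct, hvξ] at key
  rw [← Finset.filter_filter, Finset.sum_filter _ (fun x => g (u ⬝ᵥ x)), key]
  congr 1
  refine Finset.sum_congr rfl fun t _ => ?_
  rw [Finset.sum_ite_eq' _ _ (fun _ => g t)]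
  simp

theorem card_row (hπ : IsLengthTwoReduction π) {u : Fin 3 → R} (hu : π ∘ u ≠ 0)
    {ξ : Fin 3 → F} (huξ : π ∘ u ⬝ᵥ ξ = 0) :
    ({x | π ∘ x = ξ ∧ u ⬝ᵥ x = 0} : Finset (Fin 3 → R)).card = Fintype.card F ^ 2 := by
  obtain ⟨s, rfl⟩ := hπ.exists_lift ξ
  have key := hπ.sum_residue_class_one (rowHom u)
    (fun m hm => map_dotProduct_eq_zero_left _ hm)
    (fun t ht => hπ.exists_row_eq hu ht) s (fun t => if t = 0 then 1 else 0)
  simp only [rowHom_apply, RingHom.map_dotProduct, huξ] at key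
  rw [← Finset.sum_filter, Finset.filter_filter, Finset.sum_ite_eq' _ _ (fun _ => (1 : ℝ))] at key
  simp only [Finset.sum_const, Finset.mem_filter, Finset.mem_univ, map_zero, and_self, if_true,
    nsmul_eq_mul, mul_one] at key
  exact_mod_cast key

theorem card_column (hπ : IsLengthTwoReduction π) {x : Fin 3 → R} (hx : π ∘ x ≠ 0)
    {ρ : Fin 3 → F} (hρ : ρ ⬝ᵥ π ∘ x = 0) :
    ({s | π ∘ s = ρ ∧ s ⬝ᵥ x = 0} : Finset (Fin 3 → R)).card = Fintype.card F ^ 2 := by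
  obtain ⟨s, rfl⟩ := hπ.exists_lift ρ
  have key := hπ.sum_residue_class_one (colHom x)
    (fun m hm => map_dotProduct_eq_zero_right _ hm)
    (fun t ht => hπ.exists_column_eq hx ht) s (fun t => if t = 0 then 1 else 0)
  simp only [colHom_apply, RingHom.map_dotProduct, hρ] at key
  rw [← Finset.sum_filter, Finset.filter_filter, Finset.sum_ite_eq' _ _ (fun _ => (1 : ℝ))] at key
  simp only [Finset.sum_const, Finset.mem_filter, Finset.mem_univ, map_zero, and_self, if_true,
    nsmul_eq_mul, mul_one] at key
  exact_mod_cast key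

theorem card_columns (hπ : IsLengthTwoReduction π) {x y : Fin 3 → R} (hy : π ∘ y ≠ 0)
    (h : ∀ c : F, π ∘ x ≠ c • π ∘ y) {ρ : Fin 3 → F} (d : Fin 3 → R)
    (hx0 : ρ ⬝ᵥ π ∘ x = 0) (hy0 : (ρ - π ∘ d) ⬝ᵥ π ∘ y = 0) :
    ({s | π ∘ s = ρ ∧ s ⬝ᵥ x = 0 ∧ (s - d) ⬝ᵥ y = 0} : Finset (Fin 3 → R)).card =
      Fintype.card F := by
  obtain ⟨s, rfl⟩ := hπ.exists_lift ρ
  have key := hπ.sum_residue_class_two (colHom x) (colHom y)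
    (fun m hm => ⟨map_dotProduct_eq_zero_right _ hm, map_dotProduct_eq_zero_right _ hm⟩)
    (fun t t' ht ht' => hπ.exists_columns_eq hy h ht ht') s
    (fun t t' => if t = 0 ∧ t' = d ⬝ᵥ y then 1 else 0)
  rw [sub_dotProduct, sub_eq_zero] at hy0
  have hb : ∀ t t' : R, (if t = 0 ∧ t' = d ⬝ᵥ y then (1 : ℝ) else 0) =
      if t = 0 then (if t' = d ⬝ᵥ y then 1 else 0) else 0 := fun t t' => ite_and _ _ _ _
  have hsum : ∑ t with π t = π (s ⬝ᵥ x), ∑ t' with π t' = π (s ⬝ᵥ y),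
      (if t = 0 ∧ t' = d ⬝ᵥ y then (1 : ℝ) else 0) = 1 := by
    simp only [hb]
    rw [Finset.sum_eq_single 0]
    · simp only [if_true]
      simp [Finset.sum_ite_eq', RingHom.map_dotProduct, hy0]
    · intro t _ ht
      simp [ht]
    · intro h0
      simp [RingHom.map_dotProduct, hx0] at h0
  simp only [colHom_apply] at key
  rw [hsum, ← Finset.sum_filter, Finset.filter_filter] at key
  simp only [Finset.sum_const, nsmul_eq_mul, mul_one] at key
  simp only [sub_dotProduct, sub_eq_zero]
  exact_mod_cast key

end IsLengthTwoReduction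

/-! ### A finite chain ring of length two and its residue field -/

section ChainRingReduction

variable {R : Type*} [Ring R]

theorem HasChainLength.exists_generator (hlen : HasChainLength R 2) :
    ∃ θ : R, Ring.jacobson R = Ideal.span {θ} ∧ θ * θ = 0 ∧ θ ≠ 0 := by
  obtain ⟨θ, hθ, hθ2⟩ := hlen
  refine ⟨θ, hθ, ?_, ?_⟩
  · have hne : {k : ℕ | θ ^ k = 0}.Nonempty := by
      by_contra h
      rw [Set.not_nonempty_iff_eq_empty] at h
      simp [nilpotencyClass, h] at hθ2
    have := Nat.sInf_mem hne
    rw [show sInf {k : ℕ | θ ^ k = 0} = 2 from hθ2] at this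
    simpa [pow_two] using this
  · rintro rfl
    have h1 : sInf {k : ℕ | (0 : R) ^ k = 0} ≤ 1 := Nat.sInf_le (by simp)
    rw [show sInf {k : ℕ | (0 : R) ^ k = 0} = 2 from hθ2] at h1
    omega

theorem HasChainLength.nontrivial (hlen : HasChainLength R 2) : Nontrivial R := by
  obtain ⟨θ, -, -, h⟩ := hlen.exists_generator
  exact ⟨θ, 0, h⟩

variable [Finite R]

/-- Maximal left ideals are comparable, hence there is only one and it is the radical. An element
outside it generates the whole ring on the left. -/
theorem IsChainRing.isUnit_of_notMem_jacobson (hchain : IsChainRing R) {x : R}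
    (hx : x ∉ Ring.jacobson R) : IsUnit x := by
  have htop : Ideal.span {x} = ⊤ := by
    by_contra hne
    obtain ⟨m, hm, hxm⟩ := Ideal.exists_le_maximal _ hne
    apply hx
    have hxm' : x ∈ m := hxm (Ideal.mem_span_singleton_self x)
    rw [Ring.jacobson, Module.jacobson, Submodule.mem_sInf]
    intro I (hI : IsCoatom I)
    rcases hchain I m with h | h
    · rcases eq_or_lt_of_le h with h | h
      · rwa [h]
      · exact absurd (hI.2 _ h) hm.ne_top
    · exact h hxm'
  have h1 : (1 : R) ∈ Ideal.span {x} := by rw [htop]; trivial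
  obtain ⟨c, hc⟩ := Ideal.mem_span_singleton'.1 h1
  -- In a finite ring a one-sided inverse is two-sided.
  exact IsUnit.of_mul_eq_one_right _ hc

theorem IsChainRing.isField_residueRing (hchain : IsChainRing R) (hlen : HasChainLength R 2) :
    IsField (ResidueRing R) := by
  have := hlen.nontrivial
  have hne : Ring.jacobson R ≠ ⊤ := by
    obtain ⟨θ, hθ, hsq, hθ0⟩ := hlen.exists_generator
    intro h
    have h1 : (1 : R) ∈ Ideal.span {θ} := by rw [← hθ, h]; trivial
    obtain ⟨c, hc⟩ := Ideal.mem_span_singleton'.1 h1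
    apply hθ0
    rw [← one_mul θ, ← hc, mul_assoc, hsq, mul_zero]
  have : Nontrivial (ResidueRing R) := Ideal.Quotient.nontrivial_iff.2 hne
  have : NoZeroDivisors (ResidueRing R) := ⟨fun {a b} hab => by
    obtain ⟨x, rfl⟩ := Ideal.Quotient.mk_surjective a
    by_cases hx : x ∈ Ring.jacobson R
    · exact Or.inl (Ideal.Quotient.eq_zero_iff_mem.2 hx)
    · exact Or.inr (((hchain.isUnit_of_notMem_jacobson hx).map
        (Ideal.Quotient.mk _)).mul_right_eq_zero.1 hab)⟩
  have : Finite (ResidueRing R) := Finite.of_surjective _ Ideal.Quotient.mk_surjective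
  have : IsDomain (ResidueRing R) := NoZeroDivisors.to_isDomain _
  -- Wedderburn's little theorem supplies commutativity.
  exact Finite.isDomain_to_isField _

theorem IsChainRing.isLengthTwoReduction (hchain : IsChainRing R) (hlen : HasChainLength R 2) :
    letI := (hchain.isField_residueRing hlen).toField
    IsLengthTwoReduction (Ideal.Quotient.mk (Ring.jacobson R) : R →+* ResidueRing R) := by
  let := (hchain.isField_residueRing hlen).toField
  obtain ⟨θ, hθ, hsq, hθ0⟩ := hlen.exists_generator
  refine ⟨Ideal.Quotient.mk_surjective, ?_, ?_, ?_⟩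
  · intro x hx
    refine hchain.isUnit_of_notMem_jacobson fun h => hx ?_
    exact Ideal.Quotient.eq_zero_iff_mem.2 h
  · intro x y hx hy
    have hx' : x ∈ Ring.jacobson R := Ideal.Quotient.eq_zero_iff_mem.1 hx
    have hy' : y ∈ Ring.jacobson R := Ideal.Quotient.eq_zero_iff_mem.1 hy
    rw [hθ] at hx' hy'
    obtain ⟨a, rfl⟩ := Ideal.mem_span_singleton'.1 hx'
    obtain ⟨b, rfl⟩ := Ideal.mem_span_singleton'.1 hy'
    -- The radical is two-sided, so `θ * b` can be rewritten as `c * θ`; this moves the two factors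
    -- θ next to each other without commutativity.
    have h1 : θ * b ∈ Ring.jacobson R :=
      Ideal.mul_mem_right _ _ (by rw [hθ]; exact Ideal.mem_span_singleton_self θ)
    rw [hθ] at h1
    obtain ⟨c, hc⟩ := Ideal.mem_span_singleton'.1 h1
    rw [mul_assoc, ← mul_assoc θ, ← hc, mul_assoc, hsq, mul_zero, mul_zero]
  · have hker : RingHom.ker (Ideal.Quotient.mk (Ring.jacobson R) : R →+* ResidueRing R) =
        Ring.jacobson R := Ideal.ext fun x => Ideal.Quotient.eq_zero_iff_mem
    have hann : ∀ a : R, a * θ = 0 ↔ a ∈ Ring.jacobson R := by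
      intro a
      constructor
      · intro h
        by_contra ha
        exact hθ0 ((hchain.isUnit_of_notMem_jacobson ha).mul_right_eq_zero.1 h)
      · intro h
        rw [hθ] at h
        obtain ⟨c, rfl⟩ := Ideal.mem_span_singleton'.1 h
        rw [mul_assoc, hsq, mul_zero]
    -- Right multiplication by θ has the radical both as kernel and as image, so the radical has as
    -- many elements as the residue ring.
    let f : R →ₗ[R] R := LinearMap.toSpanSingleton R R θ
    have hf : LinearMap.ker f = Ring.jacobson R := by
      ext a; simp [f, LinearMap.toSpanSingleton_apply, hann]
    have hrange : LinearMap.range f = Ring.jacobson R := by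
      rw [hθ]; exact LinearMap.range_toSpanSingleton θ
    have e := f.quotKerEquivRange
    rw [hf, hrange] at e
    exact (congrArg (fun I : Ideal R => Nat.card I) hker).trans (Nat.card_congr e.toEquiv).symm

end ChainRingReduction

/-! ### Values of the homogeneous weight -/

namespace IsLengthTwoReduction

variable {R F : Type*} [Ring R] [Field F] {π : R →+* F}

/-- Lifts of the q scalars, multiplied by `t`, give q different radical elements, hence all of them.
Thus the weight is constant on the nonzero radical elements. -/
theorem span_singleton_of_map_eq_zero (hπ : IsLengthTwoReduction π) [Finite R] [Finite F] {t : R}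
    (ht : π t = 0) (ht0 : t ≠ 0) : Ideal.span {t} = RingHom.ker π := by
  choose a ha using hπ.surjective
  let e : F → RingHom.ker π := fun c => ⟨a c * t, by rw [RingHom.mem_ker, map_mul, ht, mul_zero]⟩
  have he : Function.Injective e := fun c c' h => by
    by_contra hc
    have h1 : (a c - a c') * t = 0 := by
      rw [sub_mul, sub_eq_zero]; exact congrArg Subtype.val h
    have h2 : IsUnit (a c - a c') := hπ.isUnit _ (by rwa [map_sub, ha, ha, sub_ne_zero])
    exact ht0 (h2.mul_right_eq_zero.1 h1)
  have he' : Function.Bijective e := (Nat.bijective_iff_injective_and_card e).2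
    ⟨he, hπ.card_ker.symm⟩
  apply le_antisymm
  · rwa [Ideal.span_le, Set.singleton_subset_iff]
  · intro s hs
    obtain ⟨c, hc⟩ := he'.2 ⟨s, hs⟩
    exact Ideal.mem_span_singleton'.2 ⟨a c, congrArg Subtype.val hc⟩

theorem card_eq (hπ : IsLengthTwoReduction π) [Finite R] :
    Nat.card R = Nat.card F ^ 2 := by
  have h := Submodule.card_eq_card_quotient_mul_card (RingHom.ker π)
  have e : Nat.card (R ⧸ RingHom.ker π) = Nat.card F :=
    Nat.card_congr (RingHom.quotientKerEquivOfSurjective hπ.surjective).toEquiv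
  rw [h, hπ.card_ker, sq]
  exact congrArg (Nat.card F * ·) e

theorem span_singleton_of_map_ne_zero (hπ : IsLengthTwoReduction π) {t : R} (ht : π t ≠ 0) :
    Ideal.span {t} = ⊤ := by
  obtain ⟨c, hc⟩ := (hπ.isUnit t ht).exists_left_inv
  exact (Ideal.eq_top_iff_one _).2 (Ideal.mem_span_singleton'.2 ⟨c, hc⟩)

section Weight

variable [Fintype R] [Fintype F] [DecidableEq F]

theorem card_radical (hπ : IsLengthTwoReduction π) :
    ({t | π t = 0} : Finset R).card = Fintype.card F := by
  rw [← Nat.card_eq_fintype_card, ← hπ.card_ker]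
  exact (Nat.subtype_card _ fun t => by simp [RingHom.mem_ker]).symm

theorem card_not_radical (hπ : IsLengthTwoReduction π) :
    (({t | ¬ π t = 0} : Finset R).card : ℝ) = (Fintype.card F : ℝ) ^ 2 - Fintype.card F := by
  have hc := Finset.card_filter_add_card_filter_not (s := (Finset.univ : Finset R))
    (fun s => π s = 0)
  rw [hπ.card_radical, Finset.card_univ, ← Nat.card_eq_fintype_card (α := R), hπ.card_eq,
    Nat.card_eq_fintype_card] at hc
  rw [eq_sub_iff_add_eq, add_comm]
  exact_mod_cast hc

theorem sum_weight_radical (hπ : IsLengthTwoReduction π) {w : R → ℝ}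
    (hw : IsHomogeneousWeight w 1) : ∑ t with π t = 0, w t = Fintype.card F := by
  obtain ⟨t, ht, ht0⟩ : ∃ t, π t = 0 ∧ t ≠ 0 := by
    by_contra! h
    have h1 : ({t | π t = 0} : Finset R).card ≤ 1 :=
      Finset.card_le_one.2 fun a ha b hb => by
        rw [h a (by simpa using ha), h b (by simpa using hb)]
    rw [hπ.card_radical] at h1
    exact absurd Fintype.one_lt_card (not_lt.2 h1)
  have h := hw.sum_eq t ht0
  rw [hπ.span_singleton_of_map_eq_zero ht ht0, finsum_mem_eq_finite_toFinset_sum _ (Set.toFinite _),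
    hπ.card_ker, one_mul, Nat.card_eq_fintype_card] at h
  rw [← h]
  refine Finset.sum_congr ?_ fun _ _ => rfl
  ext s
  simp

theorem weight_of_map_eq_zero (hπ : IsLengthTwoReduction π) {w : R → ℝ}
    (hw : IsHomogeneousWeight w 1) {t : R} (ht : π t = 0) (ht0 : t ≠ 0) :
    w t = Fintype.card F / (Fintype.card F - 1) := by
  classical
  have h := hπ.sum_weight_radical hw
  have h0 : (0 : R) ∈ ({t | π t = 0} : Finset R) := by simp
  have hconst : ∀ s ∈ ({t | π t = 0} : Finset R).erase 0, w s = w t := by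
    intro s hs
    simp only [Finset.mem_erase, Finset.mem_filter, Finset.mem_univ, true_and] at hs
    refine hw.eq_of_span_eq _ _ ?_
    rw [hπ.span_singleton_of_map_eq_zero ht ht0, hπ.span_singleton_of_map_eq_zero hs.2 hs.1]
  have hq : 1 < Fintype.card F := Fintype.one_lt_card
  rw [← Finset.add_sum_erase _ _ h0, hw.map_zero, zero_add, Finset.sum_congr rfl hconst,
    Finset.sum_const, Finset.card_erase_of_mem h0, hπ.card_radical, nsmul_eq_mul,
    Nat.cast_sub hq.le, Nat.cast_one] at h
  have hq' : (Fintype.card F : ℝ) - 1 ≠ 0 := by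
    have : (1 : ℝ) < Fintype.card F := by exact_mod_cast hq
    linarith
  rw [eq_div_iff hq', mul_comm, h]

theorem weight_of_map_ne_zero (hπ : IsLengthTwoReduction π) {w : R → ℝ}
    (hw : IsHomogeneousWeight w 1) {t : R} (ht : π t ≠ 0) : w t = 1 := by
  have hconst : ∀ s, π s ≠ 0 → w s = w t := fun s hs => hw.eq_of_span_eq _ _ <| by
    rw [hπ.span_singleton_of_map_ne_zero hs,
      hπ.span_singleton_of_map_ne_zero ht]
  have h := hw.sum_eq t (by rintro rfl; simp at ht)
  rw [hπ.span_singleton_of_map_ne_zero ht,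
    finsum_mem_eq_finite_toFinset_sum _ (Set.toFinite _), one_mul,
    Nat.card_congr (Submodule.topEquiv (R := R) (M := R)).toEquiv, hπ.card_eq] at h
  have hset : (Set.toFinite ((⊤ : Ideal R) : Set R)).toFinset = Finset.univ := by ext; simp
  rw [hset, ← Finset.sum_filter_add_sum_filter_not _ (fun s => π s = 0),
    hπ.sum_weight_radical hw, Finset.sum_congr rfl
      (fun s hs => hconst s (by simpa using hs)), Finset.sum_const, nsmul_eq_mul] at h
  have hq : (1 : ℝ) < Fintype.card F := by exact_mod_cast Fintype.one_lt_card
  rw [hπ.card_not_radical, Nat.card_eq_fintype_card] at h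
  push_cast at h
  have h2 : ((Fintype.card F : ℝ) ^ 2 - Fintype.card F) * (w t - 1) = 0 := by linarith
  have h3 : ((Fintype.card F : ℝ) ^ 2 - Fintype.card F) ≠ 0 := by nlinarith
  linarith [(_root_.mul_eq_zero.1 h2).resolve_left h3]

/-- The weight is defined through left ideals, whereas a point fixes its generator only up to a
right unit. This invariance makes the weight of a word independent of the chosen generators. -/
theorem weight_mul_right (hπ : IsLengthTwoReduction π) {w : R → ℝ}
    (hw : IsHomogeneousWeight w 1) (t : R) {r : R} (hr : IsUnit r) : w (t * r) = w t := by
  have hr' : π r ≠ 0 := (hr.map π).ne_zero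
  by_cases ht : π t = 0
  · by_cases ht0 : t = 0
    · rw [ht0, zero_mul]
    · rw [hπ.weight_of_map_eq_zero hw ht ht0, hπ.weight_of_map_eq_zero hw
        (by rw [map_mul, ht, zero_mul]) (by rwa [Ne, hr.mul_left_eq_zero])]
  · rw [hπ.weight_of_map_ne_zero hw ht, hπ.weight_of_map_ne_zero hw
      (by rw [map_mul]; exact mul_ne_zero ht hr')]

/-- Each of the q units in a nonzero class has weight 1, while in the radical (q - 1) · q/(q - 1) =
q. The equality of the two totals is why segments in general position contribute the same amount to
every word. -/
theorem sum_weight_residue_class (hπ : IsLengthTwoReduction π) {w : R → ℝ}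
    (hw : IsHomogeneousWeight w 1) (c : F) : ∑ t with π t = c, w t = Fintype.card F := by
  by_cases hc : c = 0
  · rw [hc, hπ.sum_weight_radical hw]
  · obtain ⟨s, rfl⟩ := hπ.surjective c
    rw [Finset.sum_congr rfl fun t ht => hπ.weight_of_map_ne_zero hw
      (by rw [(Finset.mem_filter.1 ht).2]; exact hc), Finset.sum_const, nsmul_eq_mul, mul_one,
      ← hπ.card_radical]
    congr 1
    refine Finset.card_bij' (fun t _ => t - s) (fun t _ => t + s) ?_ ?_ ?_ ?_ <;>
      simp +contextual

end Weight

end IsLengthTwoReduction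

/-! ### Points, hyperplanes and incidence in coordinates -/

open MulOpposite in
theorem mem_span_op_singleton {R : Type*} [Ring R] {k : ℕ} {x y : Fin k → R} :
    y ∈ Submodule.span Rᵐᵒᵖ {x} ↔ ∃ r : R, y = fun i => x i * r := by
  rw [Submodule.mem_span_singleton]
  constructor
  · rintro ⟨r, rfl⟩
    exact ⟨r.unop, rfl⟩
  · rintro ⟨r, rfl⟩
    exact ⟨op r, rfl⟩

/-- The linear functional on the right module `Rᵏ` with a given coordinate row. -/
def rowFunctional {R : Type*} [Ring R] {k : ℕ} (u : Fin k → R) : (Fin k → R) →ₗ[Rᵐᵒᵖ] R where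
  toFun x := u ⬝ᵥ x
  map_add' := dotProduct_add u
  map_smul' r x := by
    simp [dotProduct, Finset.sum_mul, mul_assoc]

theorem rowFunctional_apply {R : Type*} [Ring R] {k : ℕ} (u x : Fin k → R) :
    rowFunctional u x = u ⬝ᵥ x := rfl

theorem rowFunctional_smul {R : Type*} [Ring R] {k : ℕ} (r : R) (u : Fin k → R) :
    rowFunctional (r • u) = r • rowFunctional u :=
  LinearMap.ext fun x => smul_dotProduct r u x

theorem rowFunctional_single {R : Type*} [Ring R] {k : ℕ} (u : Fin k → R) :
    (fun i => rowFunctional u (Pi.single i 1)) = u := by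
  funext i
  simp [rowFunctional_apply]

theorem eq_rowFunctional {R : Type*} [Ring R] {k : ℕ} (φ : (Fin k → R) →ₗ[Rᵐᵒᵖ] R) :
    φ = rowFunctional fun i => φ (Pi.single i 1) := by
  refine LinearMap.ext fun x => ?_
  have hx : x = ∑ i, MulOpposite.op (x i) • (Pi.single i 1 : Fin k → R) := by
    funext j
    simp [Finset.sum_apply, Pi.single_apply]
  conv_lhs => rw [hx]
  rw [map_sum]
  simp [rowFunctional_apply, dotProduct]

namespace IsLengthTwoReduction

variable {R F : Type*} [Ring R] [Field F] {π : R →+* F} {k : ℕ}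

theorem exists_isUnit_of_ne_zero (hπ : IsLengthTwoReduction π) {x : Fin k → R} (hx : π ∘ x ≠ 0) :
    ∃ i, IsUnit (x i) := by
  obtain ⟨i, hi⟩ := Function.ne_iff.1 hx
  exact ⟨i, hπ.isUnit _ hi⟩

/-- A vector that is nonzero modulo the radical has a unit coordinate, from which a functional with
value 1 is read off; conversely the value 1 survives reduction. -/
theorem mem_barbPoints_iff (hπ : IsLengthTwoReduction π) {P : Submodule Rᵐᵒᵖ (Fin k → R)} :
    P ∈ barbPoints R (Fin k → R) ↔ ∃ x, π ∘ x ≠ 0 ∧ P = Submodule.span Rᵐᵒᵖ {x} := by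
  refine exists_congr fun x => and_congr_left fun _ => ⟨?_, fun hx => ?_⟩
  · rintro ⟨φ, hφ⟩ h0
    rw [eq_rowFunctional φ, rowFunctional_apply] at hφ
    have := congrArg π hφ
    rw [RingHom.map_dotProduct, h0, dotProduct_zero, map_one] at this
    exact zero_ne_one this
  · obtain ⟨i, hi⟩ := hπ.exists_isUnit_of_ne_zero hx
    obtain ⟨c, hc⟩ := hi.exists_left_inv
    exact ⟨rowFunctional (Pi.single i c), by rw [rowFunctional_apply, single_dotProduct, hc]⟩

theorem mem_barbHyperplanes_iff (hπ : IsLengthTwoReduction π)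
    {H : Submodule R ((Fin k → R) →ₗ[Rᵐᵒᵖ] R)} :
    H ∈ barbHyperplanes R (Fin k → R) ↔
      ∃ u, π ∘ u ≠ 0 ∧ H = Submodule.span R {rowFunctional u} := by
  constructor
  · rintro ⟨φ, ⟨x, hx⟩, rfl⟩
    refine ⟨fun i => φ (Pi.single i 1), fun h0 => ?_, by rw [← eq_rowFunctional]⟩
    rw [eq_rowFunctional φ, rowFunctional_apply] at hx
    have := congrArg π hx
    rw [RingHom.map_dotProduct, h0, zero_dotProduct, map_one] at this
    exact zero_ne_one this
  · rintro ⟨u, hu, rfl⟩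
    obtain ⟨i, hi⟩ := hπ.exists_isUnit_of_ne_zero hu
    obtain ⟨c, hc⟩ := hi.exists_right_inv
    exact ⟨_, ⟨Pi.single i c, by rw [rowFunctional_apply, dotProduct_single, hc]⟩, rfl⟩

/-- Changing generators multiplies the value by a scalar on the left and another on the right, so
the vanishing required for some pair of generators holds for the given one. -/
theorem barbIncident_iff (hπ : IsLengthTwoReduction π) {x u : Fin k → R} (hx : π ∘ x ≠ 0)
    (hu : π ∘ u ≠ 0) :
    BarbIncident (Submodule.span Rᵐᵒᵖ {x}) (Submodule.span R {rowFunctional u}) ↔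
      u ⬝ᵥ x = 0 := by
  constructor
  · rintro ⟨-, -, φ, y, h1, h2, h3⟩
    have hxy : x ∈ Submodule.span Rᵐᵒᵖ {y} := h2 ▸ Submodule.mem_span_singleton_self x
    have huφ : rowFunctional u ∈ Submodule.span R {φ} := h1 ▸ Submodule.mem_span_singleton_self _
    obtain ⟨r, rfl⟩ := mem_span_op_singleton.1 hxy
    obtain ⟨c, hc⟩ := Submodule.mem_span_singleton.1 huφ
    rw [← rowFunctional_apply, ← hc, eq_rowFunctional φ, LinearMap.smul_apply,
      rowFunctional_apply, dotProduct_mul_right, ← rowFunctional_apply, ← eq_rowFunctional, h3,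
      zero_mul, smul_zero]
  · intro h
    exact ⟨hπ.mem_barbPoints_iff.2 ⟨x, hx, rfl⟩, hπ.mem_barbHyperplanes_iff.2 ⟨u, hu, rfl⟩, _, _,
      rfl, rfl, h⟩

theorem span_mul_right_eq {x : Fin k → R} {r : R} (hr : IsUnit r) :
    Submodule.span Rᵐᵒᵖ {fun i => x i * r} = Submodule.span Rᵐᵒᵖ {x} := by
  obtain ⟨c, hc⟩ := hr.exists_right_inv
  apply le_antisymm <;> rw [Submodule.span_singleton_le_iff_mem, mem_span_op_singleton]
  · exact ⟨r, rfl⟩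
  · exact ⟨c, funext fun i => by rw [mul_assoc, hc, mul_one]⟩

theorem comp_mul_right (x : Fin k → R) (r : R) : π ∘ (fun i => x i * r) = π r • π ∘ x := by
  funext i; simp [mul_comm]

theorem comp_smul (x : Fin k → R) (r : R) : π ∘ (r • x) = π r • π ∘ x := by
  funext i; simp

theorem span_op_eq_iff (hπ : IsLengthTwoReduction π) {x y : Fin k → R} (hx : π ∘ x ≠ 0) :
    Submodule.span Rᵐᵒᵖ {x} = Submodule.span Rᵐᵒᵖ {y} ↔ ∃ r, IsUnit r ∧ x = fun i => y i * r := by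
  constructor
  · intro h
    have hxy : x ∈ Submodule.span Rᵐᵒᵖ {y} := h ▸ Submodule.mem_span_singleton_self x
    obtain ⟨r, rfl⟩ := mem_span_op_singleton.1 hxy
    refine ⟨r, hπ.isUnit r fun h0 => hx ?_, rfl⟩
    rw [comp_mul_right, h0, zero_smul]
  · rintro ⟨r, hr, rfl⟩
    exact span_mul_right_eq hr

section Reduction

theorem nuVec_eq_iff (hker : RingHom.ker π = Ring.jacobson R) {x y : Fin k → R} :
    nuVec x = nuVec y ↔ π ∘ x = π ∘ y := by
  simp only [funext_iff, nuVec, Function.comp_apply]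
  refine forall_congr' fun i => ?_
  rw [Submodule.Quotient.eq, ← hker, RingHom.mem_ker, map_sub, sub_eq_zero]

theorem nuVec_mem_nuPoint_iff (hker : RingHom.ker π = Ring.jacobson R) {x y : Fin k → R} :
    nuVec y ∈ nuPoint (Submodule.span Rᵐᵒᵖ {x}) ↔ ∃ r : R, π ∘ y = π r • π ∘ x := by
  constructor
  · rintro ⟨z, hz, hzy⟩
    obtain ⟨r, rfl⟩ := mem_span_op_singleton.1 hz
    exact ⟨r, by rw [← (nuVec_eq_iff hker).1 hzy, comp_mul_right]⟩
  · rintro ⟨r, hr⟩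
    exact ⟨_, mem_span_op_singleton.2 ⟨r, rfl⟩,
      (nuVec_eq_iff hker).2 (by rw [hr, comp_mul_right])⟩

theorem neighbour_span_iff (hπ : IsLengthTwoReduction π)
    (hker : RingHom.ker π = Ring.jacobson R) {x y : Fin k → R} (hx : π ∘ x ≠ 0) :
    Neighbour (Submodule.span Rᵐᵒᵖ {x}) (Submodule.span Rᵐᵒᵖ {y}) ↔
      ∃ c : F, c ≠ 0 ∧ π ∘ x = c • π ∘ y := by
  constructor
  · intro h
    have h1 : nuVec x ∈ nuPoint (Submodule.span Rᵐᵒᵖ {x}) :=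
      ⟨x, Submodule.mem_span_singleton_self x, rfl⟩
    rw [show nuPoint _ = _ from h, nuVec_mem_nuPoint_iff hker] at h1
    obtain ⟨r, hr⟩ := h1
    refine ⟨π r, fun h0 => hx ?_, hr⟩
    rw [hr, h0, zero_smul]
  · have key : ∀ {x y : Fin k → R} {c : F}, π ∘ x = c • π ∘ y →
        nuPoint (Submodule.span Rᵐᵒᵖ {x}) ⊆ nuPoint (Submodule.span Rᵐᵒᵖ {y}) := by
      rintro x y c hc _ ⟨z, hz, rfl⟩
      obtain ⟨r, rfl⟩ := mem_span_op_singleton.1 hz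
      obtain ⟨s, rfl⟩ := hπ.surjective c
      rw [nuVec_mem_nuPoint_iff hker]
      exact ⟨r * s, by rw [comp_mul_right, hc, map_mul, smul_smul]⟩
    rintro ⟨c, hc, h⟩
    refine Set.Subset.antisymm (key h) (key (c := c⁻¹) ?_)
    rw [h, smul_smul, inv_mul_cancel₀ hc, one_smul]

theorem nuHyperplane_span_eq (hπ : IsLengthTwoReduction π)
    (hker : RingHom.ker π = Ring.jacobson R) {u v : Fin k → R} {c : F} (hc : c ≠ 0)
    (h : π ∘ u = c • π ∘ v) :
    nuHyperplane (Submodule.span R {rowFunctional u}) =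
      nuHyperplane (Submodule.span R {rowFunctional v}) := by
  have key : ∀ {u v : Fin k → R} {c : F}, π ∘ u = c • π ∘ v →
      nuHyperplane (Submodule.span R {rowFunctional u}) ⊆
        nuHyperplane (Submodule.span R {rowFunctional v}) := by
    rintro u v c hc _ ⟨ψ, hψ, rfl⟩
    obtain ⟨r, rfl⟩ := Submodule.mem_span_singleton.1 hψ
    obtain ⟨s, rfl⟩ := hπ.surjective c
    refine ⟨(r * s) • rowFunctional v, Submodule.smul_mem _ _ (Submodule.mem_span_singleton_self _),
      (nuVec_eq_iff hker).2 ?_⟩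
    rw [← rowFunctional_smul, ← rowFunctional_smul, rowFunctional_single, rowFunctional_single,
      comp_smul, comp_smul, hc, map_mul, smul_smul]
  refine Set.Subset.antisymm (key h) (key (c := c⁻¹) ?_)
  rw [h, smul_smul, inv_mul_cancel₀ hc, one_smul]

end Reduction

end IsLengthTwoReduction

/-! ### Rows that define the segments -/

/-- A choice, for every nonzero vector `ξ` over the residue field, of a row `φ ξ` whose kernel cuts
out a line segment among the lifts of `ξ`; the reductions of the rows are compatible with scalars
and pairwise distinct. -/
structure IsSegmentSystem {R F : Type*} [Ring R] [Field F] (π : R →+* F)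
    (φ : (Fin 3 → F) → Fin 3 → R) : Prop where
  ne_zero : ∀ ξ, ξ ≠ 0 → π ∘ φ ξ ≠ 0
  exists_lift : ∀ ξ, ξ ≠ 0 → ∃ a, π ∘ a = ξ ∧ φ ξ ⬝ᵥ a = 0
  smul : ∀ (c : F) ξ, c ≠ 0 → ξ ≠ 0 → π ∘ φ (c • ξ) = c • π ∘ φ ξ
  smul_dotProduct : ∀ (c : F) ξ x, c ≠ 0 → ξ ≠ 0 → (φ (c • ξ) ⬝ᵥ x = 0 ↔ φ ξ ⬝ᵥ x = 0)
  injective : ∀ ξ ξ', ξ ≠ 0 → ξ' ≠ 0 → π ∘ φ ξ = π ∘ φ ξ' → ξ = ξ'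

namespace MeetsClassesInSegments

variable {R F : Type*} [Ring R] [Field F] {π : R →+* F}

/-- Coordinates for the hyperplanes attached to the classes. The last clause is the hypothesis on
directions in contrapositive form: proportional rows force neighbouring points. -/
theorem exists_rows (hπ : IsLengthTwoReduction π) (hker : RingHom.ker π = Ring.jacobson R)
    {K : Set (Submodule Rᵐᵒᵖ (Fin 3 → R))} (hK : MeetsClassesInSegments K) :
    ∃ u : (Fin 3 → R) → Fin 3 → R, (∀ x, π ∘ x ≠ 0 → π ∘ u x ≠ 0 ∧
      (∃ a, π ∘ a = π ∘ x ∧ u x ⬝ᵥ a = 0) ∧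
      (∀ z, π ∘ z = π ∘ x → (Submodule.span Rᵐᵒᵖ {z} ∈ K ↔ u x ⬝ᵥ z = 0))) ∧
      ∀ x y, π ∘ x ≠ 0 → π ∘ y ≠ 0 → ∀ c : F, c ≠ 0 → π ∘ u x = c • π ∘ u y →
        ∃ d : F, d ≠ 0 ∧ π ∘ x = d • π ∘ y := by
  obtain ⟨-, η, hη, hdir⟩ := hK
  have hpt : ∀ x : Fin 3 → R, π ∘ x ≠ 0 → Submodule.span Rᵐᵒᵖ {x} ∈ barbPoints R (Fin 3 → R) :=
    fun x hx => hπ.mem_barbPoints_iff.2 ⟨x, hx, rfl⟩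
  have hrow : ∀ x : Fin 3 → R, ∃ u : Fin 3 → R, π ∘ x ≠ 0 → π ∘ u ≠ 0 ∧
      η (Submodule.span Rᵐᵒᵖ {x}) = Submodule.span R {rowFunctional u} := by
    intro x
    by_cases hx : π ∘ x = 0
    · exact ⟨0, fun h => absurd hx h⟩
    · obtain ⟨u, h1, h2⟩ := hπ.mem_barbHyperplanes_iff.1 (hη _ (hpt x hx)).1
      exact ⟨u, fun _ => ⟨h1, h2⟩⟩
  choose u hu using hrow
  refine ⟨u, fun x hx => ⟨(hu x hx).1, ?_, ?_⟩, ?_⟩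
  · obtain ⟨g, hg, hgx, hgi⟩ := (hη _ (hpt x hx)).2.1
    obtain ⟨y, hy, rfl⟩ := hπ.mem_barbPoints_iff.1 hg
    obtain ⟨c, hc, hyx⟩ := (hπ.neighbour_span_iff hker hy).1 hgx
    rw [(hu x hx).2, hπ.barbIncident_iff hy (hu x hx).1] at hgi
    -- A neighbour has a proportional reduction; rescaling its generator makes the reduction equal
    -- to that of `x`.
    obtain ⟨r, hr⟩ := hπ.surjective c⁻¹
    refine ⟨fun i => y i * r, ?_, ?_⟩
    · rw [IsLengthTwoReduction.comp_mul_right, hr, hyx, smul_smul, inv_mul_cancel₀ hc, one_smul]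
    · rw [IsLengthTwoReduction.dotProduct_mul_right, hgi, zero_mul]
  · intro z hz
    have hz0 : π ∘ z ≠ 0 := hz ▸ hx
    have hn : Neighbour (Submodule.span Rᵐᵒᵖ {z}) (Submodule.span Rᵐᵒᵖ {x}) :=
      (hπ.neighbour_span_iff hker hz0).2 ⟨1, one_ne_zero, by rw [hz, one_smul]⟩
    have h := Set.ext_iff.1 (hη _ (hpt x hx)).2.2 (Submodule.span Rᵐᵒᵖ {z})
    rw [(hu x hx).2] at h
    rw [← hπ.barbIncident_iff hz0 (hu x hx).1]
    exact ⟨fun hzK => (h.1 ⟨hzK, hn⟩).2.2, fun hi => (h.2 ⟨hpt z hz0, hn, hi⟩).1⟩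
  · intro x y hx hy c hc hxy
    by_contra hne
    refine hdir _ (hpt x hx) _ (hpt y hy)
      (fun hn => hne ((hπ.neighbour_span_iff hker hx).1 hn)) ?_
    rw [(hu x hx).2, (hu y hy).2]
    exact hπ.nuHyperplane_span_eq hker hc hxy

/-- The rows belong to projective points, while the sums run over vectors. One representative per
line is fixed and its row is rescaled along the line, so that reduction becomes homogeneous of
degree one and hence injective on vectors, not only on lines. -/
theorem exists_segmentSystem (hπ : IsLengthTwoReduction π)
    (hker : RingHom.ker π = Ring.jacobson R)
    {K : Set (Submodule Rᵐᵒᵖ (Fin 3 → R))} (hK : MeetsClassesInSegments K) :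
    ∃ φ, IsSegmentSystem π φ ∧
      ∀ z, π ∘ z ≠ 0 → (Submodule.span Rᵐᵒᵖ {z} ∈ K ↔ φ (π ∘ z) ⬝ᵥ z = 0) := by
  classical
  obtain ⟨u, hu, hinj⟩ := hK.exists_rows hπ hker
  obtain ⟨l, hl⟩ : ∃ l : (Fin 3 → F) → Fin 3 → R, ∀ ξ, π ∘ l ξ = ξ :=
    ⟨_, fun ξ => (hπ.exists_lift ξ).choose_spec⟩
  obtain ⟨m, hm⟩ := hπ.surjective.hasRightInverse
  -- the scalar `c ξ` carries `ξ` to the representative `ρ ξ` of its line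
  have hex : ∃ (ρ : (Fin 3 → F) → Fin 3 → F) (c : (Fin 3 → F) → F), ∀ ξ, ξ ≠ 0 →
      c ξ ≠ 0 ∧ ρ ξ = c ξ • ξ ∧ ∀ d : F, d ≠ 0 → ρ (d • ξ) = ρ ξ := by
    refine ⟨fun ξ => if h : ξ = 0 then 0 else (Projectivization.mk F ξ h).rep,
      fun ξ => if h : ξ = 0 then 0 else (Projectivization.exists_smul_eq_mk_rep F ξ h).choose,
      fun ξ hξ => ⟨?_, ?_, ?_⟩⟩
    · simp [hξ]
    · simp only [hξ, dif_neg, not_false_eq_true]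
      exact (Projectivization.exists_smul_eq_mk_rep F ξ hξ).choose_spec.symm
    · intro d hd
      have hdξ : d • ξ ≠ 0 := smul_ne_zero hd hξ
      simp only [hξ, hdξ, dif_neg, not_false_eq_true]
      rw [(Projectivization.mk_eq_mk_iff' F (d • ξ) ξ hdξ hξ).2 ⟨d, rfl⟩]
  obtain ⟨ρ, c, hρ⟩ := hex
  have hρ0 : ∀ ξ, ξ ≠ 0 → ρ ξ ≠ 0 := fun ξ hξ => by
    rw [(hρ ξ hξ).2.1]; exact smul_ne_zero (hρ ξ hξ).1 hξ
  -- The normalizing scalar has degree -1 in ξ; its inverse, used in `φ` below, therefore has degree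
  -- 1.
  have hc : ∀ (d : F) ξ, d ≠ 0 → ξ ≠ 0 → c (d • ξ) * d = c ξ := fun d ξ hd hξ => by
    have h := (hρ ξ hξ).2.2 d hd
    rw [(hρ ξ hξ).2.1, (hρ _ (smul_ne_zero hd hξ)).2.1, smul_smul] at h
    exact smul_left_injective F hξ h
  have hlρ : ∀ ξ, ξ ≠ 0 → π ∘ l (ρ ξ) ≠ 0 := fun ξ hξ => by rw [hl]; exact hρ0 ξ hξ
  have hm0 : ∀ d, d ≠ 0 → IsUnit (m d) := fun d hd => hπ.isUnit _ (by rwa [hm])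
  let φ : (Fin 3 → F) → Fin 3 → R := fun ξ => m (c ξ)⁻¹ • u (l (ρ ξ))
  have hπφ : ∀ ξ, π ∘ φ ξ = (c ξ)⁻¹ • π ∘ u (l (ρ ξ)) := fun ξ => by
    rw [IsLengthTwoReduction.comp_smul, hm]
  have hφ : ∀ ξ x, ξ ≠ 0 → (φ ξ ⬝ᵥ x = 0 ↔ u (l (ρ ξ)) ⬝ᵥ x = 0) := fun ξ x hξ => by
    change (m (c ξ)⁻¹ • u (l (ρ ξ))) ⬝ᵥ x = 0 ↔ _
    rw [smul_dotProduct, smul_eq_mul, (hm0 _ (inv_ne_zero (hρ ξ hξ).1)).mul_right_eq_zero]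
  refine ⟨φ, ⟨?_, ?_, ?_, ?_, ?_⟩, ?_⟩
  · intro ξ hξ
    rw [hπφ]
    exact smul_ne_zero (inv_ne_zero (hρ ξ hξ).1) (hu _ (hlρ ξ hξ)).1
  · intro ξ hξ
    obtain ⟨a, ha, hua⟩ := (hu _ (hlρ ξ hξ)).2.1
    refine ⟨fun i => a i * m (c ξ)⁻¹, ?_, ?_⟩
    · rw [IsLengthTwoReduction.comp_mul_right, ha, hm, hl, (hρ ξ hξ).2.1, smul_smul,
        inv_mul_cancel₀ (hρ ξ hξ).1, one_smul]
    · rw [hφ ξ _ hξ, IsLengthTwoReduction.dotProduct_mul_right, hua, zero_mul]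
  · intro d ξ hd hξ
    rw [hπφ, hπφ, (hρ ξ hξ).2.2 d hd, smul_smul, ← hc d ξ hd hξ, mul_inv, mul_comm d, mul_assoc,
      inv_mul_cancel₀ hd, mul_one]
  · intro d ξ x hd hξ
    rw [hφ _ _ (smul_ne_zero hd hξ), hφ _ _ hξ, (hρ ξ hξ).2.2 d hd]
  · intro ξ ξ' hξ hξ' h
    rw [hπφ, hπφ] at h
    have hcξ := (hρ ξ hξ).1
    have hcξ' := (hρ ξ' hξ').1
    obtain ⟨d, hd, h1⟩ := hinj _ _ (hlρ ξ hξ) (hlρ ξ' hξ') (c ξ * (c ξ')⁻¹)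
      (mul_ne_zero hcξ (inv_ne_zero hcξ')) (by
        rw [mul_smul, ← h, smul_smul, mul_inv_cancel₀ hcξ, one_smul])
    rw [hl, hl, (hρ ξ hξ).2.1, (hρ ξ' hξ').2.1, smul_smul] at h1
    have h2 : ξ = ((c ξ)⁻¹ * (d * c ξ')) • ξ' := by
      rw [mul_smul, ← h1, smul_smul, inv_mul_cancel₀ hcξ, one_smul]
    have he : (c ξ)⁻¹ * (d * c ξ') ≠ 0 :=
      mul_ne_zero (inv_ne_zero hcξ) (mul_ne_zero hd hcξ')
    set e := (c ξ)⁻¹ * (d * c ξ')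
    -- Proportional vectors share a representative, so their rows differ only by the normalizing
    -- scalars; equal rows then give equal scalars and equal vectors.
    have h3 : ρ ξ = ρ ξ' := by rw [h2, (hρ ξ' hξ').2.2 e he]
    rw [h3] at h
    have h4 : c ξ = c ξ' := inv_injective (smul_left_injective F (hu _ (hlρ ξ' hξ')).1 h)
    have h5 := (hρ ξ hξ).2.1
    rw [h3, (hρ ξ' hξ').2.1, h4] at h5
    exact (smul_right_injective _ hcξ' h5).symm
  · intro z hz
    have hcz := (hρ _ hz).1
    rw [hφ _ _ hz, ← IsLengthTwoReduction.span_mul_right_eq (hm0 _ hcz),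
      (hu _ (hlρ _ hz)).2.2 _ (by
        rw [IsLengthTwoReduction.comp_mul_right, hm, hl, (hρ _ hz).2.1]),
      IsLengthTwoReduction.dotProduct_mul_right, (hm0 _ hcz).mul_left_eq_zero]

end MeetsClassesInSegments

/-! ### Weights of the words, and the polar points -/

/-- A choice, for every nonzero row `ρ` over the residue field, of a point on the line segment of
direction `ρ`. -/
structure IsPolarSystem {R F : Type*} [Ring R] [Field F] (π : R →+* F)
    (b : (Fin 3 → F) → Fin 3 → R) : Prop where
  ne_zero : ∀ ρ, ρ ≠ 0 → π ∘ b ρ ≠ 0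
  surjective : ∀ ξ, ξ ≠ 0 → ∃ ρ, ρ ≠ 0 ∧ π ∘ b ρ = ξ
  smul : ∀ (c : F) ρ, c ≠ 0 → ρ ≠ 0 → π ∘ b (c • ρ) = c • π ∘ b ρ
  injective : ∀ ρ ρ', ρ ≠ 0 → ρ' ≠ 0 → π ∘ b ρ = π ∘ b ρ' → ρ = ρ'
  dotProduct : ∀ ρ, ρ ≠ 0 → ρ ⬝ᵥ π ∘ b ρ = 0
  dotProduct_smul : ∀ (c : F) ρ u, c ≠ 0 → ρ ≠ 0 → π ∘ u = c • ρ →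
    (u ⬝ᵥ b (c • ρ) = 0 ↔ u ⬝ᵥ b ρ = 0)

namespace IsSegmentSystem

variable {R F : Type*} [Ring R] [Field F] {π : R →+* F} {φ : (Fin 3 → F) → Fin 3 → R}

theorem dotProduct (hφ : IsSegmentSystem π φ) {ξ : Fin 3 → F} (hξ : ξ ≠ 0) :
    π ∘ φ ξ ⬝ᵥ ξ = 0 := by
  obtain ⟨a, ha, h⟩ := hφ.exists_lift ξ hξ
  have := congrArg π h
  rwa [RingHom.map_dotProduct, ha, map_zero] at this

/-- An injective self-map of the finite set of nonzero vectors is onto: since the directions are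
distinct, each direction occurs. -/
theorem surjective [Finite F] (hφ : IsSegmentSystem π φ) {ρ : Fin 3 → F} (hρ : ρ ≠ 0) :
    ∃ ξ, ξ ≠ 0 ∧ π ∘ φ ξ = ρ := by
  let f : {ξ : Fin 3 → F // ξ ≠ 0} → {ξ : Fin 3 → F // ξ ≠ 0} :=
    fun ξ => ⟨π ∘ φ ξ, hφ.ne_zero ξ ξ.2⟩
  have hf : Function.Injective f := fun ξ ξ' h =>
    Subtype.ext (hφ.injective _ _ ξ.2 ξ'.2 (congrArg Subtype.val h))
  obtain ⟨ξ, h⟩ := Finite.surjective_of_injective hf ⟨ρ, hρ⟩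
  exact ⟨ξ, ξ.2, congrArg Subtype.val h⟩

/-- The vector `x - a * d` is radical, so only the reduction of `u` acts on it, and there `u` may be
replaced by a multiple of `φ ξ`, which kills both terms. Hence a row parallel to the direction of a
segment is essentially constant on it. -/
theorem dotProduct_eq_mul (hπ : IsLengthTwoReduction π)
    {ξ : Fin 3 → F} {u a x : Fin 3 → R} {c : F} (hu : π ∘ u = c • π ∘ φ ξ)
    (ha : φ ξ ⬝ᵥ a = 0) (hx : φ ξ ⬝ᵥ x = 0) {d : R} (hd : π ∘ x = π d • π ∘ a) :
    u ⬝ᵥ x = (u ⬝ᵥ a) * d := by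
  obtain ⟨r, rfl⟩ := hπ.surjective c
  rw [← IsLengthTwoReduction.dotProduct_mul_right, ← sub_eq_zero, ← dotProduct_sub,
    hπ.dotProduct_congr_left (u' := r • φ ξ)
      (by rw [hu, IsLengthTwoReduction.comp_smul])
      (IsLengthTwoReduction.sub_mem_kerVec.2
        (by rw [hd, IsLengthTwoReduction.comp_mul_right])),
    _root_.smul_dotProduct, dotProduct_sub, hx, IsLengthTwoReduction.dotProduct_mul_right, ha, zero_mul,
    sub_zero, smul_zero]

variable [Fintype R] [Fintype F] [DecidableEq R] [DecidableEq F]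

theorem sum_cone {M : Type*} [AddCommMonoid M] (φ : (Fin 3 → F) → Fin 3 → R)
    (g : (Fin 3 → R) → M) :
    ∑ z with π ∘ z ≠ 0 ∧ φ (π ∘ z) ⬝ᵥ z = 0, g z =
      ∑ ξ with ξ ≠ 0, ∑ x with π ∘ x = ξ ∧ φ ξ ⬝ᵥ x = 0, g x := by
  rw [← Finset.sum_fiberwise_of_maps_to (t := {ξ : Fin 3 → F | ξ ≠ 0}) (g := fun z => π ∘ z)
    (by simp +contextual)]
  refine Finset.sum_congr rfl fun ξ hξ => Finset.sum_congr ?_ fun _ _ => rfl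
  have hξ0 := (Finset.mem_filter.1 hξ).2
  ext x
  simp only [Finset.mem_filter, Finset.mem_univ, true_and]
  constructor
  · rintro ⟨⟨-, h⟩, rfl⟩
    exact ⟨rfl, h⟩
  · rintro ⟨rfl, h⟩
    exact ⟨⟨hξ0, h⟩, rfl⟩

theorem card_cone (hφ : IsSegmentSystem π φ) (hπ : IsLengthTwoReduction π) :
    ({z | π ∘ z ≠ 0 ∧ φ (π ∘ z) ⬝ᵥ z = 0} : Finset (Fin 3 → R)).card =
      (Fintype.card F ^ 3 - 1) * Fintype.card F ^ 2 := by
  rw [Finset.card_eq_sum_ones, sum_cone, Finset.sum_congr rfl fun ξ hξ => by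
    rw [← Finset.card_eq_sum_ones, hπ.card_row (hφ.ne_zero ξ (Finset.mem_filter.1 hξ).2)
      (hφ.dotProduct (Finset.mem_filter.1 hξ).2)], Finset.sum_const, smul_eq_mul]
  congr 1
  rw [Finset.filter_ne', Finset.card_erase_of_mem (Finset.mem_univ _), Finset.card_univ,
    Fintype.card_fun, Fintype.card_fin]

theorem sum_weight_of_map_eq_zero (hφ : IsSegmentSystem π φ) (hπ : IsLengthTwoReduction π)
    {w : R → ℝ} (hw : IsHomogeneousWeight w 1) {u : Fin 3 → R} (hu : π ∘ u = 0) (hu0 : u ≠ 0) :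
    ∑ z with π ∘ z ≠ 0 ∧ φ (π ∘ z) ⬝ᵥ z = 0, w (u ⬝ᵥ z) = (Fintype.card F : ℝ) ^ 5 := by
  choose l hl using fun ξ : Fin 3 → F => hπ.exists_lift ξ
  have h1 : ∀ ξ ∈ ({ξ | ξ ≠ 0} : Finset (Fin 3 → F)),
      ∑ x with π ∘ x = ξ ∧ φ ξ ⬝ᵥ x = 0, w (u ⬝ᵥ x) =
        (Fintype.card F : ℝ) ^ 2 * w (u ⬝ᵥ l ξ) := by
    intro ξ hξ
    have hξ0 := (Finset.mem_filter.1 hξ).2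
    have h2 : ∀ x ∈ ({x | π ∘ x = ξ ∧ φ ξ ⬝ᵥ x = 0} : Finset (Fin 3 → R)),
        w (u ⬝ᵥ x) = w (u ⬝ᵥ l ξ) := fun x hx => by
      rw [hπ.dotProduct_congr_right
        ((Finset.mem_filter.1 hx).2.1.trans (hl ξ).symm) hu]
    rw [Finset.sum_congr rfl h2, Finset.sum_const, hπ.card_row (hφ.ne_zero ξ hξ0)
      (hφ.dotProduct hξ0), nsmul_eq_mul]
    push_cast
    rfl
  -- The vector ξ = 0 is absent from the cone but present in `sum_row_radical`; its term has weight
  -- zero.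
  have h0 : u ⬝ᵥ l 0 = 0 := by
    rw [hπ.dotProduct_congr_right (x' := 0) (by rw [hl]; funext i; simp) hu, dotProduct_zero]
  have h3 := hπ.sum_row_radical hu hu0 l hl w
  rw [hπ.sum_weight_radical hw, ← Finset.add_sum_erase _ _ (Finset.mem_univ (0 : Fin 3 → F)), h0,
    hw.map_zero, zero_add] at h3
  rw [sum_cone, Finset.sum_congr rfl h1, ← Finset.mul_sum, Finset.filter_ne', h3]
  ring

/-- Inverting the permutation ξ ↦ π(φ(ξ)) assigns to a direction its segment, and `b` picks a point
there. The q³ - q vectors off the line attached to `u` contribute q² each, and the q - 1 vectors on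
it contribute q² times one common weight. -/
theorem exists_polarSystem (hφ : IsSegmentSystem π φ) (hπ : IsLengthTwoReduction π)
    {w : R → ℝ} (hw : IsHomogeneousWeight w 1) :
    ∃ b, IsPolarSystem π b ∧ ∀ u, π ∘ u ≠ 0 →
      ∑ z with π ∘ z ≠ 0 ∧ φ (π ∘ z) ⬝ᵥ z = 0, w (u ⬝ᵥ z) =
        (Fintype.card F : ℝ) ^ 2 * (((Fintype.card F : ℝ) ^ 3 - Fintype.card F) +
          (Fintype.card F - 1) * w (u ⬝ᵥ b (π ∘ u))) := by
  have hψ : ∀ ρ : Fin 3 → F, ∃ ξ, ρ ≠ 0 → ξ ≠ 0 ∧ π ∘ φ ξ = ρ := fun ρ => by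
    by_cases h : ρ = 0
    · exact ⟨0, fun h' => absurd h h'⟩
    · obtain ⟨ξ, hξ⟩ := hφ.surjective h
      exact ⟨ξ, fun _ => hξ⟩
  choose ψ hψ using hψ
  have ha : ∀ ξ : Fin 3 → F, ∃ a, ξ ≠ 0 → π ∘ a = ξ ∧ φ ξ ⬝ᵥ a = 0 := fun ξ => by
    by_cases h : ξ = 0
    · exact ⟨0, fun h' => absurd h h'⟩
    · obtain ⟨a, ha⟩ := hφ.exists_lift ξ h
      exact ⟨a, fun _ => ha⟩
  choose a ha using ha
  have hb : ∀ ρ, ρ ≠ 0 → π ∘ a (ψ ρ) = ψ ρ := fun ρ hρ => (ha _ (hψ ρ hρ).1).1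
  have hb' : ∀ ρ, ρ ≠ 0 → φ (ψ ρ) ⬝ᵥ a (ψ ρ) = 0 := fun ρ hρ => (ha _ (hψ ρ hρ).1).2
  have hψs : ∀ (c : F) ρ, c ≠ 0 → ρ ≠ 0 → ψ (c • ρ) = c • ψ ρ := fun c ρ hc hρ =>
    hφ.injective _ _ (hψ _ (smul_ne_zero hc hρ)).1 (smul_ne_zero hc (hψ ρ hρ).1) (by
      rw [(hψ _ (smul_ne_zero hc hρ)).2, hφ.smul _ _ hc (hψ ρ hρ).1, (hψ ρ hρ).2])
  refine ⟨fun ρ => a (ψ ρ), ⟨?_, ?_, ?_, ?_, ?_, ?_⟩, ?_⟩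
  · intro ρ hρ
    rw [hb ρ hρ]
    exact (hψ ρ hρ).1
  · intro ξ hξ
    have h := hφ.ne_zero ξ hξ
    exact ⟨_, h, by rw [hb _ h, hφ.injective _ _ (hψ _ h).1 hξ (hψ _ h).2]⟩
  · intro c ρ hc hρ
    rw [hb _ (smul_ne_zero hc hρ), hb ρ hρ, hψs c ρ hc hρ]
  · intro ρ ρ' hρ hρ' h
    rw [hb ρ hρ, hb ρ' hρ'] at h
    rw [← (hψ ρ hρ).2, h, (hψ ρ' hρ').2]
  · intro ρ hρ
    have h := hφ.dotProduct (hψ ρ hρ).1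
    rw [hb ρ hρ]
    rwa [(hψ ρ hρ).2] at h
  · intro c ρ u hc hρ hu
    have h1 := hb' _ (smul_ne_zero hc hρ)
    rw [hψs c ρ hc hρ, hφ.smul_dotProduct c _ _ hc (hψ ρ hρ).1] at h1
    obtain ⟨d, hd⟩ := hπ.surjective c
    have h2 := dotProduct_eq_mul hπ (ξ := ψ ρ) (u := u) (c := c) (a := a (ψ ρ))
      (x := a (c • ψ ρ)) (by rw [hu, (hψ ρ hρ).2]) (hb' ρ hρ) h1 (d := d)
      (by rw [hd, hb ρ hρ, (ha _ (smul_ne_zero hc (hψ ρ hρ).1)).1])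
    change u ⬝ᵥ a (ψ (c • ρ)) = 0 ↔ u ⬝ᵥ a (ψ ρ) = 0
    rw [hψs c ρ hc hρ, h2, (hπ.isUnit d (by rwa [hd])).mul_left_eq_zero]
  · intro u hu
    set ξ₀ := ψ (π ∘ u) with hξ₀
    have hξ₀0 : ξ₀ ≠ 0 := (hψ _ hu).1
    have hφξ₀ : π ∘ φ ξ₀ = π ∘ u := (hψ _ hu).2
    -- The vectors whose segment has direction proportional to `π ∘ u`.
    let S : Finset (Fin 3 → F) := (Finset.univ.erase 0).image fun d : F => d • ξ₀
    have hS : ∀ ξ, ξ ∈ S ↔ ∃ d : F, d ≠ 0 ∧ d • ξ₀ = ξ := by simp [S]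
    have hScard : (S.card : ℝ) = Fintype.card F - 1 := by
      rw [Finset.card_image_of_injective _ (smul_left_injective F hξ₀0),
        Finset.card_erase_of_mem (Finset.mem_univ _), Finset.card_univ,
        Nat.cast_sub Fintype.card_pos, Nat.cast_one]
    have hsub : S ⊆ Finset.univ.erase 0 := fun ξ hξ => by
      obtain ⟨d, hd, rfl⟩ := (hS ξ).1 hξ
      simpa using ⟨hd, hξ₀0⟩
    have hin : ∀ ξ ∈ S, ∑ x with π ∘ x = ξ ∧ φ ξ ⬝ᵥ x = 0, w (u ⬝ᵥ x) =
        (Fintype.card F : ℝ) ^ 2 * w (u ⬝ᵥ a ξ₀) := by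
      intro ξ hξ
      obtain ⟨d, hd, rfl⟩ := (hS ξ).1 hξ
      obtain ⟨r, rfl⟩ := hπ.surjective d
      have h0 : π r • ξ₀ ≠ 0 := smul_ne_zero hd hξ₀0
      have h2 : ∀ x ∈ ({x | π ∘ x = π r • ξ₀ ∧ φ (π r • ξ₀) ⬝ᵥ x = 0} : Finset (Fin 3 → R)),
          w (u ⬝ᵥ x) = w (u ⬝ᵥ a ξ₀) := fun x hx => by
        obtain ⟨-, hx1, hx2⟩ := Finset.mem_filter.1 hx
        rw [hφ.smul_dotProduct _ _ _ hd hξ₀0] at hx2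
        rw [dotProduct_eq_mul hπ (ξ := ξ₀) (u := u) (c := 1) (a := a ξ₀) (by rw [hφξ₀, one_smul])
          (ha _ hξ₀0).2 hx2 (d := r) (by rw [hx1, (ha _ hξ₀0).1]),
          hπ.weight_mul_right hw _ (hπ.isUnit r hd)]
      rw [Finset.sum_congr rfl h2, Finset.sum_const, hπ.card_row (hφ.ne_zero _ h0)
        (hφ.dotProduct h0), nsmul_eq_mul]
      push_cast
      rfl
    have hout : ∀ ξ ∈ (Finset.univ.erase 0) \ S,
        ∑ x with π ∘ x = ξ ∧ φ ξ ⬝ᵥ x = 0, w (u ⬝ᵥ x) = (Fintype.card F : ℝ) ^ 2 := by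
      intro ξ hξ
      obtain ⟨hξ0, hξS⟩ := Finset.mem_sdiff.1 hξ
      have hξ0 : ξ ≠ 0 := Finset.ne_of_mem_erase hξ0
      rw [hπ.sum_rows (hφ.ne_zero ξ hξ0) _ (hφ.dotProduct hξ0), hπ.sum_weight_residue_class hw, sq]
      intro c hc
      have hc0 : c ≠ 0 := by rintro rfl; exact hu (by simpa using hc)
      -- By homogeneity and injectivity, proportional directions would put ξ on the excluded line.
      rw [← hφ.smul c ξ hc0 hξ0, ← hφξ₀] at hc
      have h := hφ.injective _ _ hξ₀0 (smul_ne_zero hc0 hξ0) hc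
      exact hξS ((hS ξ).2 ⟨c⁻¹, inv_ne_zero hc0,
        by rw [h, smul_smul, inv_mul_cancel₀ hc0, one_smul]⟩)
    have hcard : ((Finset.univ.erase (0 : Fin 3 → F)).card : ℝ) =
        (Fintype.card F : ℝ) ^ 3 - 1 := by
      rw [Finset.card_erase_of_mem (Finset.mem_univ _), Finset.card_univ,
        Nat.cast_sub Fintype.card_pos, Fintype.card_fun, Fintype.card_fin]
      push_cast
      rfl
    rw [sum_cone, Finset.filter_ne', ← Finset.sum_sdiff hsub, Finset.sum_congr rfl hout,
      Finset.sum_congr rfl hin, Finset.sum_const, Finset.sum_const, nsmul_eq_mul, nsmul_eq_mul,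
      Finset.card_sdiff_of_subset hsub, Nat.cast_sub (Finset.card_le_card hsub), hcard, hScard]
    ring

end IsSegmentSystem

/-! ### The rows of smaller weight form a partial difference set -/

namespace IsPolarSystem

open IsLengthTwoReduction

variable {R F : Type*} [Ring R] [Field F] {π : R →+* F} {b : (Fin 3 → F) → Fin 3 → R}


theorem comp_sub (u d : Fin 3 → R) : π ∘ (u - d) = π ∘ u - π ∘ d := by
  funext i; simp

variable [Fintype R] [DecidableEq R] [DecidableEq F]

/-- The rows `u` that vanish on the chosen point of the segment whose direction is the reduction
of `u`. -/
def polarSet (π : R →+* F) (b : (Fin 3 → F) → Fin 3 → R) : Finset (Fin 3 → R) :=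
  {u | π ∘ u ≠ 0 ∧ u ⬝ᵥ b (π ∘ u) = 0}

theorem mem_polarSet {u : Fin 3 → R} :
    u ∈ polarSet π b ↔ π ∘ u ≠ 0 ∧ u ⬝ᵥ b (π ∘ u) = 0 := by
  simp [polarSet]

/-- When `s` reduces to a multiple of `π ∘ d`, so does `s - d`, and all points `b` along that line
impose the same condition. The value c = 1 is excluded because then `s - d` is radical. -/
theorem dotProduct_smul_sub (hb : IsPolarSystem π b) {d s : Fin 3 → R}
    (hd : π ∘ d ≠ 0) {c : F} (hs : π ∘ s = c • π ∘ d) :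
    s - d ∈ polarSet π b ↔ c ≠ 1 ∧ (s - d) ⬝ᵥ b (π ∘ d) = 0 := by
  have h1 : π ∘ (s - d) = (c - 1) • π ∘ d := by rw [comp_sub, hs, sub_smul, one_smul]
  rw [mem_polarSet]
  by_cases hc : c = 1
  · simp [h1, hc]
  · have hc' : c - 1 ≠ 0 := sub_ne_zero.2 hc
    rw [and_iff_right (by rw [h1]; exact smul_ne_zero hc' hd), and_iff_right hc]
    conv_lhs => rw [h1]
    exact hb.dotProduct_smul _ _ _ hc' hd h1

theorem neg_mem_polarSet (hb : IsPolarSystem π b) {u : Fin 3 → R} (hu : u ∈ polarSet π b) :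
    -u ∈ polarSet π b := by
  rw [mem_polarSet] at hu ⊢
  have h1 : π ∘ (-u) = (-1 : F) • π ∘ u := by funext i; simp
  have h2 : (-1 : F) ≠ 0 := neg_ne_zero.2 one_ne_zero
  refine ⟨by rw [h1]; exact smul_ne_zero h2 hu.1, ?_⟩
  conv_lhs => rw [h1]
  rw [hb.dotProduct_smul _ _ _ h2 hu.1 h1, neg_dotProduct, hu.2, neg_zero]

variable [Fintype F]

theorem card_filter_polarSet (P : (Fin 3 → R) → Prop) [DecidablePred P] :
    ({s ∈ polarSet π b | P s} : Finset _).card =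
      ∑ σ ∈ Finset.univ.erase (0 : Fin 3 → F),
        ({s | π ∘ s = σ ∧ s ⬝ᵥ b σ = 0 ∧ P s} : Finset (Fin 3 → R)).card := by
  rw [Finset.card_eq_sum_card_fiberwise (f := fun s => π ∘ s)
    (t := Finset.univ.erase (0 : Fin 3 → F))
    (fun s hs => by
      have h := mem_polarSet.1 (Finset.mem_filter.1 hs).1
      simpa using h.1)]
  refine Finset.sum_congr rfl fun σ hσ => congrArg Finset.card ?_
  ext s
  simp only [Finset.mem_filter, mem_polarSet, Finset.mem_univ, true_and]
  constructor
  · rintro ⟨⟨⟨-, h1⟩, h2⟩, rfl⟩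
    exact ⟨rfl, h1, h2⟩
  · rintro ⟨rfl, h1, h2⟩
    exact ⟨⟨⟨Finset.ne_of_mem_erase hσ, h1⟩, h2⟩, rfl⟩

theorem card_erase_zero : (Finset.univ.erase (0 : Fin 3 → F)).card = Fintype.card F ^ 3 - 1 := by
  rw [Finset.card_erase_of_mem (Finset.mem_univ _), Finset.card_univ, Fintype.card_fun,
    Fintype.card_fin]

theorem card_polarSet (hb : IsPolarSystem π b) (hπ : IsLengthTwoReduction π) :
    (polarSet π b).card = (Fintype.card F ^ 3 - 1) * Fintype.card F ^ 2 := by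
  have h := card_filter_polarSet (π := π) (b := b) fun _ => True
  simp only [Finset.filter_true, and_true] at h
  rw [h, Finset.sum_congr rfl fun σ hσ => hπ.card_column
    (hb.ne_zero σ (Finset.ne_of_mem_erase hσ)) (hb.dotProduct σ (Finset.ne_of_mem_erase hσ)),
    Finset.sum_const, card_erase_zero, smul_eq_mul]

/-- The product `d ⬝ᵥ b σ` depends only on the reduction of `b σ`, which runs once through the
nonzero vectors. A nonzero radical row annihilates q² of the q³ vectors of F³; the zero vector is
then discarded. -/
theorem card_dotProduct_eq_zero (hb : IsPolarSystem π b) (hπ : IsLengthTwoReduction π)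
    {d : Fin 3 → R} (hd : π ∘ d = 0) (hd0 : d ≠ 0) :
    ({σ ∈ Finset.univ.erase (0 : Fin 3 → F) | d ⬝ᵥ b σ = 0} : Finset _).card =
      Fintype.card F ^ 2 - 1 := by
  choose l hl using fun ξ : Fin 3 → F => hπ.exists_lift ξ
  have hl0 : d ⬝ᵥ l 0 = 0 := by
    rw [hπ.dotProduct_congr_right (x' := 0) (by rw [hl]; funext i; simp) hd, dotProduct_zero]
  have h := hπ.sum_row_radical hd hd0 l hl fun t => if t = 0 then 1 else 0
  rw [← Finset.sum_filter, ← Finset.sum_filter, Finset.filter_filter, Finset.sum_const,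
    Finset.sum_const, nsmul_eq_mul, nsmul_eq_mul, mul_one, mul_one] at h
  have h1 : ({t | π t = 0 ∧ t = 0} : Finset R) = {0} := by
    ext t
    simp only [Finset.mem_filter, Finset.mem_univ, true_and, Finset.mem_singleton,
      and_iff_right_iff_imp]
    rintro rfl
    exact map_zero π
  rw [h1, Finset.card_singleton, Nat.cast_one, mul_one] at h
  have h2 : ({ξ | d ⬝ᵥ l ξ = 0} : Finset (Fin 3 → F)).card = Fintype.card F ^ 2 := by
    exact_mod_cast h
  rw [← h2, ← Finset.card_erase_of_mem (a := 0) (by simpa using hl0)]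
  refine Finset.card_bij (fun σ _ => π ∘ b σ) ?_ ?_ ?_
  · intro σ hσ
    simp only [Finset.mem_filter, Finset.mem_erase, Finset.mem_univ, and_true, true_and] at hσ ⊢
    refine ⟨hb.ne_zero σ hσ.1, ?_⟩
    rw [hπ.dotProduct_congr_right (hl _) hd, hσ.2]
  · intro σ hσ σ' hσ' h
    simp only [Finset.mem_filter, Finset.mem_erase, Finset.mem_univ, and_true] at hσ hσ'
    exact hb.injective σ σ' hσ.1 hσ'.1 h
  · intro ξ hξ
    simp only [Finset.mem_filter, Finset.mem_erase, Finset.mem_univ, true_and] at hξ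
    obtain ⟨σ, hσ, rfl⟩ := hb.surjective ξ hξ.1
    refine ⟨σ, ?_, rfl⟩
    simp only [Finset.mem_filter, Finset.mem_erase, Finset.mem_univ, and_true]
    refine ⟨hσ, ?_⟩
    rw [← hπ.dotProduct_congr_right (hl _) hd, hξ.2]

/-- Subtracting a radical `d` leaves the reduction σ unchanged, so both conditions are tested at the
same point `b σ`. A fibre counts fully or not at all, according to whether `d` vanishes there. -/
theorem card_sub_mem_of_map_eq_zero (hb : IsPolarSystem π b) (hπ : IsLengthTwoReduction π)
    {d : Fin 3 → R} (hd : π ∘ d = 0) (hd0 : d ≠ 0) :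
    ({s ∈ polarSet π b | s - d ∈ polarSet π b} : Finset _).card =
      (Fintype.card F ^ 2 - 1) * Fintype.card F ^ 2 := by
  have hfib : ∀ σ ∈ Finset.univ.erase (0 : Fin 3 → F),
      ({s | π ∘ s = σ ∧ s ⬝ᵥ b σ = 0 ∧ s - d ∈ polarSet π b} : Finset (Fin 3 → R)).card =
        if d ⬝ᵥ b σ = 0 then Fintype.card F ^ 2 else 0 := by
    intro σ hσ
    have hσ0 := Finset.ne_of_mem_erase hσ
    split_ifs with h
    · rw [← hπ.card_column (hb.ne_zero σ hσ0) (hb.dotProduct σ hσ0)]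
      congr 1
      ext s
      simp only [Finset.mem_filter, Finset.mem_univ, true_and, mem_polarSet, comp_sub, hd, sub_zero]
      constructor
      · rintro ⟨h1, h2, -⟩
        exact ⟨h1, h2⟩
      · rintro ⟨rfl, h2⟩
        exact ⟨rfl, h2, hσ0, by rw [sub_dotProduct, h2, h, sub_zero]⟩
    · rw [Finset.card_eq_zero, Finset.filter_eq_empty_iff]
      rintro s - ⟨rfl, h1, h2⟩
      rw [mem_polarSet, comp_sub, hd, sub_zero, sub_dotProduct, h1, zero_sub, neg_eq_zero] at h2
      exact h h2.2
  rw [card_filter_polarSet, Finset.sum_congr rfl hfib, ← Finset.sum_filter, Finset.sum_const,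
    hb.card_dotProduct_eq_zero hπ hd hd0, smul_eq_mul]

/-- The nonzero multiples of a vector over a finite field. -/
def nonzeroMultiples (δ : Fin 3 → F) : Finset (Fin 3 → F) :=
  (Finset.univ.erase 0).image fun c : F => c • δ

theorem mem_nonzeroMultiples {δ σ : Fin 3 → F} :
    σ ∈ nonzeroMultiples δ ↔ ∃ c : F, c ≠ 0 ∧ c • δ = σ := by
  simp [nonzeroMultiples]

theorem card_nonzeroMultiples {δ : Fin 3 → F} (hδ : δ ≠ 0) :
    (nonzeroMultiples δ).card = Fintype.card F - 1 := by
  rw [nonzeroMultiples, Finset.card_image_of_injective _ (smul_left_injective F hδ),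
    Finset.card_erase_of_mem (Finset.mem_univ _), Finset.card_univ]

theorem nonzeroMultiples_subset {δ : Fin 3 → F} (hδ : δ ≠ 0) :
    nonzeroMultiples δ ⊆ Finset.univ.erase 0 := fun σ hσ => by
  obtain ⟨c, hc, rfl⟩ := mem_nonzeroMultiples.1 hσ
  simpa using ⟨hc, hδ⟩

/-- The conditions on `s` are taken at `b σ` and `b (σ - π ∘ d)`. If these were proportional modulo
the radical, injectivity of the reductions would make σ and `σ - π ∘ d` proportional, and σ a
multiple of `π ∘ d`. -/
theorem card_sub_mem_fibre_off_line (hb : IsPolarSystem π b) (hπ : IsLengthTwoReduction π)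
    {d : Fin 3 → R} (hd : π ∘ d ≠ 0) {σ : Fin 3 → F}
    (hσ : σ ∈ Finset.univ.erase 0 \ nonzeroMultiples (π ∘ d)) :
    ({s | π ∘ s = σ ∧ s ⬝ᵥ b σ = 0 ∧ s - d ∈ polarSet π b} : Finset (Fin 3 → R)).card =
      Fintype.card F := by
  obtain ⟨hσ0, hσd⟩ := Finset.mem_sdiff.1 hσ
  have hσ0 := Finset.ne_of_mem_erase hσ0
  have hsub : σ - π ∘ d ≠ 0 := fun h =>
    hσd (mem_nonzeroMultiples.2 ⟨1, one_ne_zero, by rw [one_smul, sub_eq_zero.1 h]⟩)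
  have hind : ∀ c : F, π ∘ b σ ≠ c • π ∘ b (σ - π ∘ d) := by
    intro c hc
    have hc0 : c ≠ 0 := by rintro rfl; exact hb.ne_zero σ hσ0 (by simpa using hc)
    rw [← hb.smul c _ hc0 hsub] at hc
    have h := hb.injective _ _ hσ0 (smul_ne_zero hc0 hsub) hc
    have h1 : c • π ∘ d = (c - 1) • σ := by
      rw [smul_sub] at h
      rw [sub_smul, one_smul, eq_sub_iff_add_eq]
      nth_rewrite 1 [h]
      rw [add_sub_cancel]
    have hc1 : c - 1 ≠ 0 := fun h0 => by
      rw [h0, zero_smul] at h1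
      exact smul_ne_zero hc0 hd h1
    refine hσd (mem_nonzeroMultiples.2 ⟨(c - 1)⁻¹ * c, mul_ne_zero (inv_ne_zero hc1) hc0, ?_⟩)
    rw [mul_smul, h1, smul_smul, inv_mul_cancel₀ hc1, one_smul]
  rw [← hπ.card_columns (hb.ne_zero _ hsub) hind d (hb.dotProduct σ hσ0) (hb.dotProduct _ hsub)]
  congr 1
  ext s
  simp only [Finset.mem_filter, Finset.mem_univ, true_and, mem_polarSet, comp_sub]
  constructor
  · rintro ⟨rfl, h1, -, h2⟩
    exact ⟨rfl, h1, h2⟩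
  · rintro ⟨rfl, h1, h2⟩
    exact ⟨rfl, h1, hsub, h2⟩

/-- On the line of `π ∘ d` both conditions are taken at `b (π ∘ d)`, and their difference would
force `d` into the set. Only the q³ - q fibres off the line remain. -/
theorem card_sub_mem_of_notMem (hb : IsPolarSystem π b) (hπ : IsLengthTwoReduction π)
    {d : Fin 3 → R} (hd : π ∘ d ≠ 0) (hdS : d ∉ polarSet π b) :
    ({s ∈ polarSet π b | s - d ∈ polarSet π b} : Finset _).card =
      (Fintype.card F ^ 3 - Fintype.card F) * Fintype.card F := by
  have hline : ∀ σ ∈ nonzeroMultiples (π ∘ d),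
      ({s | π ∘ s = σ ∧ s ⬝ᵥ b σ = 0 ∧ s - d ∈ polarSet π b} : Finset (Fin 3 → R)).card = 0 := by
    intro σ hσ
    obtain ⟨c, hc, rfl⟩ := mem_nonzeroMultiples.1 hσ
    rw [Finset.card_eq_zero, Finset.filter_eq_empty_iff]
    rintro s - ⟨h1, h2, h3⟩
    rw [hb.dotProduct_smul _ _ _ hc hd h1] at h2
    rw [hb.dotProduct_smul_sub hd h1, sub_dotProduct, h2, zero_sub, neg_eq_zero] at h3
    exact hdS (mem_polarSet.2 ⟨hd, h3.2⟩)
  rw [card_filter_polarSet, ← Finset.sum_sdiff (nonzeroMultiples_subset hd),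
    Finset.sum_congr rfl fun σ hσ => hb.card_sub_mem_fibre_off_line hπ hd hσ,
    Finset.sum_congr rfl hline, Finset.sum_const, Finset.sum_const_zero, add_zero, smul_eq_mul,
    Finset.card_sdiff_of_subset (nonzeroMultiples_subset hd), card_erase_zero,
    card_nonzeroMultiples hd]
  have : 0 < Fintype.card F := Fintype.card_pos
  congr 1
  omega

/-- Here the second condition on the line follows from the first. Of the q - 1 nonzero multiples of
`π ∘ d` only `π ∘ d` itself fails, and the other q - 2 contribute full fibres of size q². -/
theorem card_sub_mem_of_mem (hb : IsPolarSystem π b) (hπ : IsLengthTwoReduction π)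
    {d : Fin 3 → R} (hdS : d ∈ polarSet π b) :
    ({s ∈ polarSet π b | s - d ∈ polarSet π b} : Finset _).card =
      (Fintype.card F ^ 3 - Fintype.card F) * Fintype.card F +
        (Fintype.card F - 2) * Fintype.card F ^ 2 := by
  obtain ⟨hd, hdb⟩ := mem_polarSet.1 hdS
  have hline : ∀ σ ∈ nonzeroMultiples (π ∘ d),
      ({s | π ∘ s = σ ∧ s ⬝ᵥ b σ = 0 ∧ s - d ∈ polarSet π b} : Finset (Fin 3 → R)).card =
        if σ = π ∘ d then 0 else Fintype.card F ^ 2 := by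
    intro σ hσ
    obtain ⟨c, hc, rfl⟩ := mem_nonzeroMultiples.1 hσ
    have hcd : c • π ∘ d = π ∘ d ↔ c = 1 := by
      constructor
      · intro h
        exact smul_left_injective F hd (h.trans (one_smul F _).symm)
      · rintro rfl
        rw [one_smul]
    have hσ0 : c • π ∘ d ≠ 0 := smul_ne_zero hc hd
    split_ifs with h
    · rw [Finset.card_eq_zero, Finset.filter_eq_empty_iff]
      rintro s - ⟨h1, -, h3⟩
      exact ((hb.dotProduct_smul_sub hd h1).1 h3).1 (hcd.1 h)
    · rw [← hπ.card_column (hb.ne_zero _ hσ0) (hb.dotProduct _ hσ0)]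
      congr 1
      ext s
      simp only [Finset.mem_filter, Finset.mem_univ, true_and]
      constructor
      · rintro ⟨h1, h2, -⟩
        exact ⟨h1, h2⟩
      · rintro ⟨h1, h2⟩
        refine ⟨h1, h2, (hb.dotProduct_smul_sub hd h1).2 ⟨fun h' => h (hcd.2 h'), ?_⟩⟩
        rw [sub_dotProduct, (hb.dotProduct_smul _ _ _ hc hd h1).1 h2, hdb, sub_zero]
  have hmem : π ∘ d ∈ nonzeroMultiples (π ∘ d) :=
    mem_nonzeroMultiples.2 ⟨1, one_ne_zero, one_smul _ _⟩
  rw [card_filter_polarSet, ← Finset.sum_sdiff (nonzeroMultiples_subset hd),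
    Finset.sum_congr rfl fun σ hσ => hb.card_sub_mem_fibre_off_line hπ hd hσ,
    Finset.sum_congr rfl hline, ← Finset.add_sum_erase _ _ hmem, if_pos rfl, zero_add,
    Finset.sum_congr rfl fun σ hσ => if_neg (Finset.ne_of_mem_erase hσ), Finset.sum_const,
    Finset.sum_const, smul_eq_mul, smul_eq_mul, Finset.card_erase_of_mem hmem,
    Finset.card_sdiff_of_subset (nonzeroMultiples_subset hd), card_erase_zero,
    card_nonzeroMultiples hd]
  have : 0 < Fintype.card F := Fintype.card_pos
  congr 2
  omega

end IsPolarSystem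

/-! ### From difference sets to strongly regular graphs -/

/-- The graph defined by a partial difference set of an abelian group is strongly regular. -/
theorem isStronglyRegular_of_differenceSet {A V : Type*} [AddCommGroup A] [Fintype A]
    [DecidableEq A] [Finite V] (G : SimpleGraph V) (e : A ≃ V) (S : Finset A)
    (hadj : ∀ x y, G.Adj (e x) (e y) ↔ x - y ∈ S) {N K l m : ℕ} (hN : Fintype.card A = N)
    (hK : S.card = K) (hl : ∀ d ∈ S, ({s ∈ S | s - d ∈ S} : Finset A).card = l)
    (hm : ∀ d, d ≠ 0 → d ∉ S → ({s ∈ S | s - d ∈ S} : Finset A).card = m)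
    (hne : S.Nonempty) (hnt : ∃ d, d ≠ 0 ∧ d ∉ S) : IsStronglyRegular G N K l m := by
  classical
  let := Fintype.ofFinite V
  have hcommon : ∀ x y, Fintype.card (G.commonNeighbors (e x) (e y)) =
      ({s ∈ S | s - (x - y) ∈ S} : Finset A).card := by
    intro x y
    rw [← Fintype.card_coe]
    -- The common neighbours are written as `x - s`: adjacency to `x` becomes `s ∈ S`, and adjacency
    -- to `y` becomes `s - (x - y) ∈ S`.
    refine (Fintype.card_congr (((Equiv.subLeft x).trans e).subtypeEquiv fun s => ?_)).symm
    rw [SimpleGraph.mem_commonNeighbors, Finset.mem_filter]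
    simp only [Equiv.trans_apply, Equiv.subLeft_apply, hadj, sub_sub_cancel]
    rw [show y - (x - s) = s - (x - y) by abel]
  have hS0 : (0 : A) ∉ S := fun h => by
    rw [← sub_self (0 : A), ← hadj] at h
    exact G.loopless.irrefl _ h
  refine ⟨?_, ?_, ⟨?_, ?_, ?_, ?_⟩⟩
  · rintro rfl
    obtain ⟨s, hs⟩ := hne
    rw [← sub_zero s, ← hadj] at hs
    exact hs
  · rintro rfl
    obtain ⟨d, hd, hdS⟩ := hnt
    rw [← sub_zero d, ← hadj, SimpleGraph.top_adj, Ne, e.apply_eq_iff_eq, not_not] at hdS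
    exact hd hdS
  · rw [← Fintype.card_congr e, hN]
  · intro v
    obtain ⟨x, rfl⟩ := e.surjective v
    rw [← SimpleGraph.card_neighborSet_eq_degree, ← hK, ← Fintype.card_coe]
    refine (Fintype.card_congr (((Equiv.subLeft x).trans e).subtypeEquiv fun s => ?_)).symm
    rw [SimpleGraph.mem_neighborSet]
    simp only [Equiv.trans_apply, Equiv.subLeft_apply, hadj, sub_sub_cancel]
  · intro v w hvw
    obtain ⟨x, rfl⟩ := e.surjective v
    obtain ⟨y, rfl⟩ := e.surjective w
    have h := (hcommon x y).trans (hl _ ((hadj x y).1 hvw))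
    convert h
  · intro v w hne hvw
    obtain ⟨x, rfl⟩ := e.surjective v
    obtain ⟨y, rfl⟩ := e.surjective w
    have h := (hcommon x y).trans
      (hm _ (sub_ne_zero.2 fun h => hne (congrArg e h)) (mt (hadj x y).2 hvw))
    convert h

/-! ### From the cone of generators to the columns of the matrix -/

section ColumnSums

open IsLengthTwoReduction

variable {R F : Type*} [Ring R] [Field F] {π : R →+* F} [Fintype R] [Fintype F]
  [DecidableEq R] [DecidableEq F] {K : Set (Submodule Rᵐᵒᵖ (Fin 3 → R))}
  {φ : (Fin 3 → F) → Fin 3 → R} {n : ℕ} {Y : Matrix (Fin 3) (Fin n) R}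

/-- The cone is the disjoint union, over the columns, of their q² - q right unit multiples. With `f`
= 1 this yields the length, with `f` = w(u·z) the weight of a word. -/
theorem IsLengthTwoReduction.sum_cone_eq_sum_columns (hπ : IsLengthTwoReduction π)
    (hKp : K ⊆ barbPoints R (Fin 3 → R))
    (hφK : ∀ z, π ∘ z ≠ 0 → (Submodule.span Rᵐᵒᵖ {z} ∈ K ↔ φ (π ∘ z) ⬝ᵥ z = 0))
    (hY : Set.BijOn (columnSpan Y) Set.univ K) (f : (Fin 3 → R) → ℝ)
    (hf : ∀ z r, IsUnit r → f (fun i => z i * r) = f z) :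
    ∑ z with π ∘ z ≠ 0 ∧ φ (π ∘ z) ⬝ᵥ z = 0, f z =
      ((Fintype.card F : ℝ) ^ 2 - Fintype.card F) * ∑ j, f fun i => Y i j := by
  have hcol : ∀ j, π ∘ (fun i => Y i j) ≠ 0 := fun j h => by
    obtain ⟨x, hx, hspan⟩ := hπ.mem_barbPoints_iff.1 (hKp (hY.mapsTo (Set.mem_univ j)))
    obtain ⟨r, -, rfl⟩ := (hπ.span_op_eq_iff hx).1 hspan.symm
    rw [comp_mul_right, h, smul_zero] at hx
    exact hx rfl
  have hrhs : ((Fintype.card F : ℝ) ^ 2 - Fintype.card F) * ∑ j, f (fun i => Y i j) =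
      ∑ p ∈ (Finset.univ : Finset (Fin n)) ×ˢ ({r | ¬ π r = 0} : Finset R),
        f fun i => Y i p.1 * p.2 := by
    rw [Finset.sum_product, Finset.mul_sum]
    refine Finset.sum_congr rfl fun j _ => ?_
    rw [← hπ.card_not_radical, ← nsmul_eq_mul, ← Finset.sum_const]
    exact Finset.sum_congr rfl fun r hr =>
      (hf _ r (hπ.isUnit r (Finset.mem_filter.1 hr).2)).symm
  rw [hrhs]
  symm
  refine Finset.sum_bij (fun p _ i => Y i p.1 * p.2) ?_ ?_ ?_ fun _ _ => rfl
  · rintro ⟨j, r⟩ hp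
    have hr : π r ≠ 0 := by simpa using hp
    have hne : π ∘ (fun i => Y i j * r) ≠ 0 := by
      rw [comp_mul_right]; exact smul_ne_zero hr (hcol j)
    rw [Finset.mem_filter]
    refine ⟨Finset.mem_univ _, hne, (hφK _ hne).1 ?_⟩
    rw [span_mul_right_eq (hπ.isUnit r hr)]
    exact hY.mapsTo (Set.mem_univ j)
  · rintro ⟨j, r⟩ hp ⟨j', r'⟩ hp' h
    have hr : π r ≠ 0 := by simpa using hp
    have hr' : π r' ≠ 0 := by simpa using hp'
    have hjj : j = j' := by
      refine hY.injOn (Set.mem_univ _) (Set.mem_univ _) ?_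
      rw [columnSpan, columnSpan, ← span_mul_right_eq (hπ.isUnit r hr), h,
        span_mul_right_eq (hπ.isUnit r' hr')]
    subst hjj
    obtain ⟨i, hi⟩ := hπ.exists_isUnit_of_ne_zero (hcol j)
    exact Prod.ext rfl (hi.mul_left_cancel (congrFun h i))
  · intro z hz
    obtain ⟨-, hz0, hzφ⟩ := Finset.mem_filter.1 hz
    obtain ⟨j, -, hj⟩ := hY.surjOn ((hφK z hz0).2 hzφ)
    obtain ⟨r, hr, rfl⟩ := (hπ.span_op_eq_iff hz0).1 hj.symm
    exact ⟨(j, r), by simpa using (hr.map π).ne_zero, rfl⟩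

theorem IsSegmentSystem.card_columns (hφ : IsSegmentSystem π φ) (hπ : IsLengthTwoReduction π)
    (hKp : K ⊆ barbPoints R (Fin 3 → R))
    (hφK : ∀ z, π ∘ z ≠ 0 → (Submodule.span Rᵐᵒᵖ {z} ∈ K ↔ φ (π ∘ z) ⬝ᵥ z = 0))
    (hY : Set.BijOn (columnSpan Y) Set.univ K) :
    n = Fintype.card F * (Fintype.card F ^ 2 + Fintype.card F + 1) := by
  have h := hπ.sum_cone_eq_sum_columns hKp hφK hY (fun _ => 1) fun _ _ _ => rfl
  rw [Finset.sum_const, Finset.sum_const, hφ.card_cone hπ, nsmul_eq_mul, nsmul_eq_mul,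
    Finset.card_univ, Fintype.card_fin, mul_one, mul_one, Nat.cast_mul,
    Nat.cast_sub (Nat.one_le_pow _ _ Fintype.card_pos)] at h
  push_cast at h
  have hq : (1 : ℝ) < Fintype.card F := by exact_mod_cast Fintype.one_lt_card
  have hq0 : (Fintype.card F : ℝ) ^ 2 - Fintype.card F ≠ 0 := by nlinarith
  have : (n : ℝ) = Fintype.card F * (Fintype.card F ^ 2 + Fintype.card F + 1) := by
    refine mul_left_cancel₀ hq0 ?_
    rw [← h]
    ring
  exact_mod_cast this

theorem IsSegmentSystem.exists_codeWeight_vecMul (hφ : IsSegmentSystem π φ)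
    (hπ : IsLengthTwoReduction π) (hw : IsHomogeneousWeight (homWeight R) 1)
    (hKp : K ⊆ barbPoints R (Fin 3 → R))
    (hφK : ∀ z, π ∘ z ≠ 0 → (Submodule.span Rᵐᵒᵖ {z} ∈ K ↔ φ (π ∘ z) ⬝ᵥ z = 0))
    (hY : Set.BijOn (columnSpan Y) Set.univ K) :
    ∃ b, IsPolarSystem π b ∧ ∀ u, u ≠ 0 → codeWeight (Matrix.vecMul u Y) =
      if u ∈ IsPolarSystem.polarSet π b
      then ((Fintype.card F : ℝ) ^ 4 - (Fintype.card F : ℝ) ^ 2) / ((Fintype.card F : ℝ) - 1)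
      else (Fintype.card F : ℝ) ^ 4 / ((Fintype.card F : ℝ) - 1) := by
  obtain ⟨b, hb, hsum⟩ := hφ.exists_polarSystem hπ hw
  refine ⟨b, hb, fun u hu0 => ?_⟩
  have hq : (1 : ℝ) < Fintype.card F := by exact_mod_cast Fintype.one_lt_card
  have hq0 : (Fintype.card F : ℝ) ^ 2 - Fintype.card F ≠ 0 := by nlinarith
  have hq1 : (Fintype.card F : ℝ) - 1 ≠ 0 := by linarith
  have h := hπ.sum_cone_eq_sum_columns hKp hφK hY (fun z => homWeight R (u ⬝ᵥ z))
    fun z r hr => by rw [dotProduct_mul_right, hπ.weight_mul_right hw _ hr]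
  change _ = _ * codeWeight (Matrix.vecMul u Y) at h
  refine mul_left_cancel₀ hq0 ?_
  rw [← h]
  by_cases hu : π ∘ u = 0
  · rw [hφ.sum_weight_of_map_eq_zero hπ hw hu hu0, if_neg
      (fun hS => (IsPolarSystem.mem_polarSet.1 hS).1 hu)]
    -- The claim is q⁵ = (q² - q) · q⁴/(q - 1).
    field_simp
  · rw [hsum u hu]
    split_ifs with hS
    · rw [(IsPolarSystem.mem_polarSet.1 hS).2, hw.map_zero]
      field_simp
      ring
    · have h0 : u ⬝ᵥ b (π ∘ u) ≠ 0 := fun h0 => hS (IsPolarSystem.mem_polarSet.2 ⟨hu, h0⟩)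
      rw [hπ.weight_of_map_eq_zero hw
        (by rw [RingHom.map_dotProduct, hb.dotProduct _ hu]) h0]
      field_simp
      ring

end ColumnSums

/-! ### The code, its weights and its graph -/

section CodeOf

variable {R : Type*} [Ring R] {n : ℕ}

theorem range_vecMulLinear_eq_codeOf {k : ℕ} (Y : Matrix (Fin k) (Fin n) R) :
    LinearMap.range (Matrix.vecMulLinear Y) = codeOf Y :=
  range_vecMulLinear Y

theorem mem_codeOf_iff {k : ℕ} {Y : Matrix (Fin k) (Fin n) R} {c : Fin n → R} :
    c ∈ codeOf Y ↔ ∃ u, Matrix.vecMul u Y = c := by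
  rw [← range_vecMulLinear_eq_codeOf]
  rfl

theorem codeWeight_zero (hw : IsHomogeneousWeight (homWeight R) 1) :
    codeWeight (0 : Fin n → R) = 0 := by
  simp [codeWeight, hw.map_zero]

end CodeOf

section CodeOfSegments

open IsPolarSystem

variable {R F : Type*} [Ring R] [Field F] {π : R →+* F} [Fintype R] [Fintype F]
  [DecidableEq F] {b : (Fin 3 → F) → Fin 3 → R}

theorem IsLengthTwoReduction.exists_radical_ne_zero (hπ : IsLengthTwoReduction π) :
    ∃ u : Fin 3 → R, π ∘ u = 0 ∧ u ≠ 0 := by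
  obtain ⟨t, ht, ht0⟩ := Finset.exists_mem_ne
    (s := ({t | π t = 0} : Finset R)) (by rw [hπ.card_radical]; exact Fintype.one_lt_card) 0
  refine ⟨fun _ => t, funext fun i => (Finset.mem_filter.1 ht).2, fun h => ht0 (congrFun h 0)⟩

theorem polarSet_nonempty [DecidableEq R] (hb : IsPolarSystem π b) (hπ : IsLengthTwoReduction π) :
    (polarSet π b).Nonempty := by
  rw [← Finset.card_pos, hb.card_polarSet hπ]
  have hq : 1 < Fintype.card F := Fintype.one_lt_card
  have h3 : 1 < Fintype.card F ^ 3 := Nat.one_lt_pow (by norm_num) hq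
  exact Nat.mul_pos (by omega) (by positivity)

end CodeOfSegments

open IsPolarSystem in
theorem IsLengthTwoReduction.code_of_segments {R F : Type*} [Ring R] [Field F] {π : R →+* F}
    [Fintype R] [Fintype F] (hπ : IsLengthTwoReduction π)
    (hw : IsHomogeneousWeight (homWeight R) 1) (hker : RingHom.ker π = Ring.jacobson R)
    {K : Set (Submodule Rᵐᵒᵖ (Fin 3 → R))} (hK : MeetsClassesInSegments K)
    {n : ℕ} {Y : Matrix (Fin 3) (Fin n) R} (hY : Set.BijOn (columnSpan Y) Set.univ K)
    {q : ℕ} (hq : Fintype.card F = q) :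
    n = q * (q ^ 2 + q + 1) ∧
    Module.Free R (codeOf Y) ∧ Module.finrank R (codeOf Y) = 3 ∧
    IsTwoWeightCode (codeOf Y)
      (((q : ℝ) ^ 4 - (q : ℝ) ^ 2) / ((q : ℝ) - 1)) ((q : ℝ) ^ 4 / ((q : ℝ) - 1)) ∧
    IsStronglyRegular
      (codeGraph (codeOf Y) (((q : ℝ) ^ 4 - (q : ℝ) ^ 2) / ((q : ℝ) - 1)))
      (q ^ 6) (q ^ 5 - q ^ 2) (q ^ 4 + q ^ 3 - 3 * q ^ 2) (q ^ 2 * (q ^ 2 - 1)) := by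
  classical
  have : Nontrivial R := π.domain_nontrivial
  obtain ⟨φ, hφ, hφK⟩ := hK.exists_segmentSystem hπ hker
  obtain ⟨b, hb, hwt⟩ := hφ.exists_codeWeight_vecMul hπ hw hK.1 hφK hY
  have hn := hφ.card_columns hπ hK.1 hφK hY
  have hS := hb.card_polarSet hπ
  have hrad := fun d => hb.card_sub_mem_of_map_eq_zero (d := d) hπ
  have hout := fun d => hb.card_sub_mem_of_notMem (d := d) hπ
  have hin := fun d => hb.card_sub_mem_of_mem (d := d) hπ
  have hq2 : 2 ≤ q := hq ▸ Fintype.one_lt_card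
  rw [hq] at hwt hn hS
  simp only [hq] at hrad hout hin
  have hq1 : (1 : ℝ) < q := by exact_mod_cast hq2
  have hw1 : 0 < ((q : ℝ) ^ 4 - (q : ℝ) ^ 2) / ((q : ℝ) - 1) := by
    have h : (q : ℝ) ^ 4 - (q : ℝ) ^ 2 = q ^ 2 * ((q - 1) * (q + 1)) := by ring
    have h' : (0 : ℝ) < q - 1 := by linarith
    rw [h]
    positivity
  have hw2 : 0 < (q : ℝ) ^ 4 / ((q : ℝ) - 1) := by
    have h' : (0 : ℝ) < q - 1 := by linarith
    positivity
  have hw12 : ((q : ℝ) ^ 4 - (q : ℝ) ^ 2) / ((q : ℝ) - 1) ≠ (q : ℝ) ^ 4 / ((q : ℝ) - 1) := by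
    refine ne_of_lt (div_lt_div_of_pos_right ?_ (by linarith))
    have : 0 < (q : ℝ) ^ 2 := by positivity
    linarith
  set w₁ := ((q : ℝ) ^ 4 - (q : ℝ) ^ 2) / ((q : ℝ) - 1)
  set w₂ := (q : ℝ) ^ 4 / ((q : ℝ) - 1)
  have hpos : ∀ u : Fin 3 → R, u ≠ 0 → 0 < codeWeight (Matrix.vecMul u Y) := fun u hu => by
    rw [hwt u hu]
    split_ifs
    exacts [hw1, hw2]
  -- Positivity of the weight on all nonzero rows already gives freeness: a nonzero row cannot
  -- produce the zero word.
  have hinj : Function.Injective (Matrix.vecMulLinear Y) := by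
    rw [injective_iff_map_eq_zero]
    intro u hu
    by_contra hu0
    have h := hpos u hu0
    rw [show Matrix.vecMul u Y = 0 from hu, codeWeight_zero hw] at h
    exact lt_irrefl _ h
  have hrange : LinearMap.range (Matrix.vecMulLinear Y) = codeOf Y :=
    range_vecMulLinear_eq_codeOf Y
  let e : (Fin 3 → R) ≃ₗ[R] codeOf Y :=
    (LinearEquiv.ofInjective _ hinj).trans (LinearEquiv.ofEq _ _ hrange)
  have he : ∀ u, (e u : Fin n → R) = Matrix.vecMul u Y := fun u => rfl
  have hS0 : (0 : Fin 3 → R) ∉ polarSet π b := fun h =>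
    (mem_polarSet.1 h).1 (by funext i; simp)
  -- A nonzero radical row attains w₂ and shows that the graph is not complete.
  obtain ⟨v, hv, hv0⟩ := hπ.exists_radical_ne_zero
  have hvS : v ∉ polarSet π b := fun h => (mem_polarSet.1 h).1 hv
  have hw_iff : ∀ u : Fin 3 → R, u ≠ 0 →
      (codeWeight (Matrix.vecMul u Y) = w₁ ↔ u ∈ polarSet π b) := fun u hu => by
    rw [hwt u hu]
    split_ifs with h
    · simp [h]
    · simp [h, hw12.symm]
  refine ⟨hn, Module.Free.of_equiv e, ?_, ⟨?_, hw12, ?_⟩, ?_⟩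
  · rw [← e.finrank_eq, Module.finrank_fin_fun]
  · intro c hc hc0
    obtain ⟨u, rfl⟩ := mem_codeOf_iff.1 hc
    exact hpos u fun h => hc0 (by rw [h, Matrix.zero_vecMul])
  · ext t
    simp only [Set.mem_sdiff, Set.mem_image, SetLike.mem_coe, Set.mem_singleton_iff,
      Set.mem_insert_iff]
    constructor
    · rintro ⟨⟨c, hc, rfl⟩, hc0⟩
      obtain ⟨u, rfl⟩ := mem_codeOf_iff.1 hc
      have hu : u ≠ 0 := fun h => hc0 (by rw [h, Matrix.zero_vecMul, codeWeight_zero hw])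
      rw [hwt u hu]
      split_ifs
      exacts [Or.inl rfl, Or.inr rfl]
    · rintro (rfl | rfl)
      · obtain ⟨u, hu⟩ := polarSet_nonempty hb hπ
        have hu0 : u ≠ 0 := fun h => hS0 (h ▸ hu)
        exact ⟨⟨_, mem_codeOf_iff.2 ⟨u, rfl⟩, (hw_iff u hu0).2 hu⟩, hw1.ne'⟩
      · exact ⟨⟨_, mem_codeOf_iff.2 ⟨v, rfl⟩, by rw [hwt v hv0, if_neg hvS]⟩, hw2.ne'⟩
  · have h3 : 1 ≤ q ^ 3 := Nat.one_le_pow _ _ (by omega)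
    have hq3 : q ≤ q ^ 3 := Nat.le_self_pow (by norm_num) q
    have hmu : (q ^ 3 - q) * q = q ^ 2 * (q ^ 2 - 1) := by
      rw [Nat.sub_mul, Nat.mul_sub]
      ring_nf
    refine isStronglyRegular_of_differenceSet _ e.toEquiv (polarSet π b) ?_ ?_ ?_ ?_ ?_
      (polarSet_nonempty hb hπ) ⟨v, hv0, hvS⟩
    · intro x y
      have hsub : ∀ x y : Fin 3 → R, (e x : Fin n → R) - e y = Matrix.vecMul (x - y) Y :=
        fun x y => by rw [he, he, Matrix.sub_vecMul]
      change (codeGraph _ w₁).Adj (e x) (e y) ↔ _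
      rw [codeGraph, SimpleGraph.fromRel_adj, hsub, hsub, Ne, e.injective.eq_iff]
      constructor
      · rintro ⟨hne, h | h⟩
        · exact (hw_iff _ (sub_ne_zero.2 hne)).1 h
        · rw [← neg_sub]
          exact hb.neg_mem_polarSet ((hw_iff _ (sub_ne_zero.2 (Ne.symm hne))).1 h)
      · intro h
        have hne : x - y ≠ 0 := fun h0 => hS0 (h0 ▸ h)
        exact ⟨sub_ne_zero.1 hne, Or.inl ((hw_iff _ hne).2 h)⟩
    · rw [Fintype.card_fun, Fintype.card_fin, ← Nat.card_eq_fintype_card, hπ.card_eq,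
        Nat.card_eq_fintype_card, hq, ← pow_mul]
    · rw [hS, Nat.sub_mul]
      ring_nf
    · intro d hd
      rw [hin d hd]
      -- Writing q = 2 + p makes every truncated subtraction genuine, so the identity for λ can be
      -- checked over the integers.
      obtain ⟨p, rfl⟩ := Nat.exists_eq_add_of_le hq2
      zify [hq3, show 2 ≤ 2 + p by omega,
        show 3 * (2 + p) ^ 2 ≤ (2 + p) ^ 4 + (2 + p) ^ 3 by nlinarith [sq_nonneg p]]
      ring
    · intro d hd0 hdS
      by_cases hd : π ∘ d = 0
      · rw [hrad d hd hd0, mul_comm]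
      · rw [hout d hd hdS, hmu]

theorem mainTheorem6 {R : Type*} [Ring R] [Finite R] (hchain : IsChainRing R)
    (hlen : HasChainLength R 2) (q : ℕ) (hq : Nat.card (ResidueRing R) = q)
    (K : Set (Submodule Rᵐᵒᵖ (Fin 3 → R))) (hK : MeetsClassesInSegments K)
    (n : ℕ) (Y : Matrix (Fin 3) (Fin n) R) (hY : Set.BijOn (columnSpan Y) Set.univ K) :
    n = q * (q ^ 2 + q + 1) ∧
    Module.Free R (codeOf Y) ∧ Module.finrank R (codeOf Y) = 3 ∧
    IsTwoWeightCode (codeOf Y)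
      (((q : ℝ) ^ 4 - (q : ℝ) ^ 2) / ((q : ℝ) - 1)) ((q : ℝ) ^ 4 / ((q : ℝ) - 1)) ∧
    IsStronglyRegular
      (codeGraph (codeOf Y) (((q : ℝ) ^ 4 - (q : ℝ) ^ 2) / ((q : ℝ) - 1)))
      (q ^ 6) (q ^ 5 - q ^ 2) (q ^ 4 + q ^ 3 - 3 * q ^ 2) (q ^ 2 * (q ^ 2 - 1)) := by
  classical
  let := Fintype.ofFinite R
  let := (hchain.isField_residueRing hlen).toField
  have : Finite (ResidueRing R) := Finite.of_surjective _ Ideal.Quotient.mk_surjective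
  let := Fintype.ofFinite (ResidueRing R)
  exact (hchain.isLengthTwoReduction hlen).code_of_segments
    (isHomogeneousWeight_homWeight hchain hlen)
    (Ideal.ext fun _ => Ideal.Quotient.eq_zero_iff_mem) hK hY
    (by rw [← Nat.card_eq_fintype_card, hq])
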